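/- Let $\mathcal X$ be a nonempty compact metric space (for example a finite set, or a compact subset of $\mathbb R^d$), let $k:\mathcal X\times\mathcal X\to\mathbb R$ be a kernel with $k(x,x)\le 1$ for all $x$, and let $f\sim\mathcal{GP}(0,k)$ have continuous sample paths. Let $\sigma>0$. In iteration $t=1,2,\dots$ a point $x_t\in\mathcal X$ is queried and $y_t=f(x_t)+\epsilon_t$ is observed, where $\epsilon_t\sim\mathcal N(0,\sigma^2)$ is independent of everything that precedes it. Let $\mathcal D_{t-1}=((x_i,y_i))_{i=1}^{t-1}$, $\mathbf k_{t-1}(x)=(k(x,x_i))_{i<t}$, $\mathbf K=(k(x_i,x_j))_{i,j<t}$, $\mathbf y_{t-1}=(y_i)_{i<t}$ and $$\mu_{t-1}(x)=\mathbf k_{t-1}(x)^\top(\mathbf K+\sigma^2 I)^{-1}\mathbf y_{t-1},\qquad \sigma_{t-1}^2(x)=k(x,x)-\mathbf k_{t-1}(x)^\top(\mathbf K+\sigma^2 I)^{-1}\mathbf k_{t-1}(x).$$ In iteration $t$ a sample path $g_t$ is drawn from the posterior, that is, from the conditional law of $f$ given $\mathcal D_{t-1}$, and $g^*_t=\max_{x\in\mathcal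 X}g_t(x)$. The algorithm sees $f$ only through the data: given $\mathcal D_{t-1}$, the pair $(g_t,x_t)$ is conditionally independent of $f$. The algorithm is GP-EIMS if, with ties broken in any such way, $$x_t\in\operatorname*{arg\,max}_{x\in\mathcal X}\ \mathrm{EI}\bigl(\mu_{t-1}(x),\sigma_{t-1}(x),g^*_t\bigr),\qquad \mathrm{EI}(m,s,u)=\mathbb E_{Z\sim\mathcal N(m,s^2)}\bigl[\max\{Z-u,0\}\bigr].$$ Put $$\eta_t=\frac{g^*_t-\mu_{t-1}(x_t)}{\sigma_{t-1}(x_t)}\ \ (\text{with }\eta_t=0\text{ if }\sigma_{t-1}(x_t)=0),\qquad \mathrm{BCR}_T=\sum_{t=1}^T\mathbb E\bigl[f(x^*)-f(x_t)\bigr],\quad f(x^*)=\max_{x\in\mathcal X}f(x),$$ $$C_1=\frac{2}{\log(1+\sigma^{-2})},\qquad \gamma_T=\sup_{a_1,\dots,a_T\in\mathcal X} I(\mathbf y_A;\mathbf f_A),$$ where $\mathbf f_A=(f(a_i))_{i\le T}$, $\mathbf y_A=\mathbf f_A+\mathbf e$ with $\mathbf e\sim\mathcal N(0,\sigma^2I_T)$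 independent of $f$, and $I$ is the Shannon mutual information (in nats; the $a_i$ may repeat). Suppose that the algorithm is GP-EIMS, or that it is an arbitrary algorithm as above and $k(x,x)>0$ for all $x\in\mathcal X$. Then for every $T\ge 0$ the expectations in $\mathrm{BCR}_T$ exist and are finite, and $$\mathrm{BCR}_T\le\sqrt{\mathbb E\Bigl[\sum_{t=1}^T\eta_t^2\,\mathbb 1\{\eta_t\ge 0\}\Bigr]}\ \sqrt{C_1\gamma_T},$$ where the first expectation may be $+\infty$ (and $\infty\cdot 0=0$). -/

import Mathlib

open MeasureTheory ProbabilityTheory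
open scoped ENNReal NNReal

/-- The space of continuous functions carries its Borel `σ`-algebra (for a compact metrizable
domain, this is the `σ`-algebra generated by the point evaluations). -/
instance continuousMapMeasurableSpace {S : Type*} [TopologicalSpace S] :
    MeasurableSpace C(S, ℝ) := borel _

instance continuousMapBorelSpace {S : Type*} [TopologicalSpace S] : BorelSpace C(S, ℝ) := ⟨rfl⟩

noncomputable section

namespace BayesOpt

/-! ### Gaussian process regression -/

/-- `f ∼ GP(0, k)`, with continuous sample paths. -/
structure IsGPPrior {Ω S : Type*} [MeasurableSpace Ω] [TopologicalSpace S]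
    (P : Measure Ω) (f : Ω → C(S, ℝ)) (k : S → S → ℝ) : Prop where
  measurable : Measurable f
  gaussian : IsGaussianProcess (fun (z : S) (ω : Ω) => f ω z) P
  mean_eq : ∀ z, ∫ ω, f ω z ∂P = 0
  cov_eq : ∀ z z', cov[fun ω => f ω z, fun ω => f ω z'; P] = k z z'

/-- The regularized kernel matrix `K + v I` of the inputs `x 0, …, x (n - 1)`. -/
def regKernelMatrix {S : Type*} (k : S → S → ℝ) (v : ℝ) {n : ℕ} (x : Fin n → S) :
    Matrix (Fin n) (Fin n) ℝ :=
  Matrix.of (fun i j => k (x i) (x j)) + v • (1 : Matrix (Fin n) (Fin n) ℝ)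

/-- The posterior mean at `z` for the data `d = ((x₁, y₁), …, (xₙ, yₙ))` and noise variance `v`. -/
def posteriorMean {S : Type*} (k : S → S → ℝ) (v : ℝ) {n : ℕ} (d : Fin n → S × ℝ) (z : S) : ℝ :=
  (fun i => k z (d i).1) ⬝ᵥ
    Matrix.mulVec (regKernelMatrix k v (fun i => (d i).1))⁻¹ (fun i => (d i).2)

/-- The posterior variance at `z`. -/
def posteriorVar {S : Type*} (k : S → S → ℝ) (v : ℝ) {n : ℕ} (d : Fin n → S × ℝ) (z : S) : ℝ :=
  k z z - (fun i => k z (d i).1) ⬝ᵥ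
    Matrix.mulVec (regKernelMatrix k v (fun i => (d i).1))⁻¹ (fun i => k z (d i).1)

/-- The posterior standard deviation at `z`. -/
def posteriorStd {S : Type*} (k : S → S → ℝ) (v : ℝ) {n : ℕ} (d : Fin n → S × ℝ) (z : S) : ℝ :=
  √(posteriorVar k v d z)

/-! ### Maximum information gain -/

/-- The Shannon mutual information of `X` and `Y`, in nats: the relative entropy of the joint law
with respect to the product of the marginal laws. -/
def mutualInformation {Ω A B : Type*} [MeasurableSpace Ω] [MeasurableSpace A] [MeasurableSpace B]
    (P : Measure Ω) (X : Ω → A) (Y : Ω → B) : ℝ≥0∞ :=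
  InformationTheory.klDiv (P.map (fun ω => (X ω, Y ω))) ((P.map X).prod (P.map Y))

/-- The maximum information gain `γ_T`, for a random function with law `Q` and noise variance `v`.
The `T` inputs `a 0, …, a (T - 1)` may repeat, and the noise vector has independent `N(0, v)`
entries and is independent of the function. -/
def maxInformationGain {S : Type*} [TopologicalSpace S] (Q : Measure C(S, ℝ)) (v : ℝ≥0) (T : ℕ) :
    ℝ≥0∞ :=
  ⨆ a : Fin T → S,
    mutualInformation (Q.prod (Measure.pi fun _ : Fin T => gaussianReal 0 v))
      (fun p i => p.1 (a i) + p.2 i) (fun p i => p.1 (a i))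

/-! ### Bayesian optimization

Rounds are indexed by `n = 0, 1, …`: round `n` is the `(n + 1)`-st iteration, at the beginning of
which `n` observations are available. -/

/-- The data `(x_i, y_i)`, `i < n`, with `y_i = f(x_i) + ε_i`. -/
def data {Ω S : Type*} [TopologicalSpace S] (f : Ω → C(S, ℝ)) (x : ℕ → Ω → S) (ε : ℕ → Ω → ℝ)
    (n : ℕ) (ω : Ω) : Fin n → S × ℝ :=
  fun i => (x i ω, f ω (x i ω) + ε i ω)

/-- The maximum of a continuous function (attained if the domain is compact and nonempty). -/
def maxValue {S : Type*} [TopologicalSpace S] (h : C(S, ℝ)) : ℝ := ⨆ z, h z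

/-- A run of a Bayesian optimization algorithm on the objective `f`, with noise variance `v`, that
generates posterior sample paths `g n` and queries the points `x n`. -/
structure IsRun {Ω S : Type*} [MeasurableSpace Ω] [MetricSpace S] [CompactSpace S]
    [MeasurableSpace S]
    (P : Measure Ω) [IsFiniteMeasure P] (f : Ω → C(S, ℝ)) (v : ℝ≥0)
    (x : ℕ → Ω → S) (ε : ℕ → Ω → ℝ) (g : ℕ → Ω → C(S, ℝ)) : Prop where
  measurable_x : ∀ n, Measurable (x n)
  measurable_ε : ∀ n, Measurable (ε n)
  measurable_g : ∀ n, Measurable (g n)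
  /-- `g n` is drawn from the posterior, the conditional law of `f` given the current data. -/
  sample_law : ∀ n, HasCondDistrib (g n) (data f x ε n)
    (condDistrib f (data f x ε n) P) P
  /-- Given the current data, `(g n, x n)` is conditionally independent of `f`: the algorithm sees
  `f` only through the data. -/
  no_peeking : ∀ n, HasCondDistrib f (fun ω => (data f x ε n ω, (g n ω, x n ω)))
    (Kernel.prodMkRight (C(S, ℝ) × S) (condDistrib f (data f x ε n) P)) P
  noise_law : ∀ n, HasLaw (ε n) (gaussianReal 0 v) P
  /-- The noise of a round is independent of everything that precedes it. -/
  noise_indep : ∀ n, IndepFun (ε n) (fun ω => (f ω, data f x ε n ω, g n ω, x n ω)) P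

/-- The expected improvement `E[max (Z - u) 0]` of `Z ∼ N(m, w)` over the reference value `u`. -/
def expectedImprovement (m w u : ℝ) : ℝ :=
  ∫ z, max (z - u) 0 ∂(gaussianReal m w.toNNReal)

/-- The query rule of GP-EIMS: each query maximizes the expected improvement over the maximum of
the posterior sample path. Ties may be broken in any way. -/
def IsGPEIMS {Ω S : Type*} [TopologicalSpace S] (k : S → S → ℝ) (v : ℝ)
    (f : Ω → C(S, ℝ)) (x : ℕ → Ω → S) (ε : ℕ → Ω → ℝ) (g : ℕ → Ω → C(S, ℝ)) : Prop :=
  ∀ n ω, IsMaxOn (fun z => expectedImprovement (posteriorMean k v (data f x ε n ω) z)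
    (posteriorVar k v (data f x ε n ω) z) (maxValue (g n ω))) Set.univ (x n ω)

/-- `η = (g* - μ(x)) / σ(x)` in round `n`. -/
def eta {Ω S : Type*} [TopologicalSpace S] (k : S → S → ℝ) (v : ℝ)
    (f : Ω → C(S, ℝ)) (x : ℕ → Ω → S) (ε : ℕ → Ω → ℝ) (g : ℕ → Ω → C(S, ℝ)) (n : ℕ) (ω : Ω) : ℝ :=
  (maxValue (g n ω) - posteriorMean k v (data f x ε n ω) (x n ω)) /
    posteriorStd k v (data f x ε n ω) (x n ω)

/-- The regret `f(x*) - f(x n)` of round `n`, where `x*` maximizes `f`. -/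
def regret {Ω S : Type*} [TopologicalSpace S] (f : Ω → C(S, ℝ)) (x : ℕ → Ω → S)
    (n : ℕ) (ω : Ω) : ℝ :=
  maxValue (f ω) - f ω (x n ω)

/-- The Bayesian cumulative regret of the first `T` rounds. -/
def bcr {Ω S : Type*} [MeasurableSpace Ω] [TopologicalSpace S] (P : Measure Ω)
    (f : Ω → C(S, ℝ)) (x : ℕ → Ω → S) (T : ℕ) : ℝ :=
  ∑ n ∈ Finset.range T, ∫ ω, regret f x n ω ∂P

end BayesOpt

end

/-!
The Bayesian regret of posterior-sampling algorithms is bounded by comparing, round by round, the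
regret with the posterior standard deviation at the query.

*Regret and posterior.* Given the data, the posterior sample path has the conditional law of `f`,
so its maximum `g*` has the same expectation as the maximum of `f` (`IsRun.map_sample`); and since
the query `x` is conditionally independent of `f`, the value `f(x)` has the same expectation as
the conditional mean of `f` at `x`. Hence the expected regret of a round is `E[g* - μ(x)]`
(`IsRun.integral_regret`). All expectations are finite because the norm of a Gaussian random
function is integrable, by Fernique's theorem.

*The conditional mean is the formula `μ`.* By induction on the rounds, the joint law of the data
and `f` has the Gaussian likelihood as density with respect to the product of some measure on the
data and the prior (`IsRun.exists_density`), because neither the choice of a query nor the noise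
depends on `f` beyond the data. So the posterior is given by Bayes' rule as if the inputs had been
fixed beforehand (`IsRun.condDistrib_ae_eq`). For fixed inputs, the error of the linear predictor
`μ` is independent of the observations, whence its mean against the likelihood vanishes
(`integral_eval_mul_likelihood`).

*The gap.* Write `s(x)` for the posterior standard deviation. By definition of `η`,
`g* - μ(x) = η s(x)` if `s(x) > 0`. If `s(x) = 0`, then `k(x, x) = 0`, since noisy observations
cannot remove all uncertainty, and `μ(x) = 0`. This is excluded if the prior variance is positive.
Under GP-EIMS, if also `g* > 0`, the maximal expected improvement is `0`, which forces `s` and thus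
the prior variance to vanish everywhere. But then the sample path vanishes almost surely, a
contradiction. Thus almost surely `g* - μ(x) ≤ max η 0 * s(x)` (`IsRun.ae_gap_le`).

*Information gain.* The Cauchy–Schwarz inequality leaves the sum of the posterior variances at the
queries. For any inputs, `I(y; f) = log (det (K + σ² I) / det (σ² I)) / 2`
(`mutualInformation_obs`), and by Schur complements this is the sum of `log (1 + w / σ²) / 2` over
the successive posterior variances `w`, which lie in `[0, 1]`. Concavity of the logarithm then
bounds the sum of the variances by `2 / log (1 + σ⁻²)` times the information gain
(`IsGPPrior.sum_posteriorVar_le`).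
-/

namespace BayesOpt

/-! ### Gaussian measures on path space -/

/-- Finitely many values of a Gaussian process, possibly with repetitions, are jointly Gaussian. -/
lemma hasGaussianLaw_comp {Ω T ι : Type*} [MeasurableSpace Ω] [Fintype ι] {P : Measure Ω}
    {X : T → Ω → ℝ} (hX : IsGaussianProcess X P) (a : ι → T) :
    HasGaussianLaw (fun ω i => X (a i) ω) P := by
  classical
  let L : ((Finset.univ.image a) → ℝ) →L[ℝ] ι → ℝ :=
    { toFun x i := x ⟨a i, by simp⟩
      map_add' x y := by ext; simp
      map_smul' m x := by ext; simp }
  exact (hX.hasGaussianLaw _).map L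

section Eval

variable {S : Type*} [TopologicalSpace S] {Q : Measure C(S, ℝ)} {k : S → S → ℝ}

lemma measurable_eval (z : S) : Measurable (fun h : C(S, ℝ) => h z) :=
  (continuous_eval_const z).measurable

/-- The law of a Gaussian process with continuous paths, seen as a random function on path space. -/
lemma IsGPPrior.map {Ω : Type*} [MeasurableSpace Ω] {P : Measure Ω} {f : Ω → C(S, ℝ)}
    (hf : IsGPPrior P f k) : IsGPPrior (P.map f) (fun h => h) k where
  measurable := measurable_id
  gaussian := by
    refine ⟨fun I => ⟨?_⟩⟩
    have h := (hf.gaussian.hasGaussianLaw I).isGaussian_map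
    have hm : Measurable (fun (h : C(S, ℝ)) => I.restrict fun x => h x) :=
      measurable_pi_lambda _ fun i => measurable_eval _
    rwa [Measure.map_map hm hf.measurable]
  mean_eq z := by
    rw [integral_map hf.measurable.aemeasurable (measurable_eval z).aestronglyMeasurable]
    exact hf.mean_eq z
  cov_eq z z' := by
    rw [covariance_map (measurable_eval z).aestronglyMeasurable
      (measurable_eval z').aestronglyMeasurable hf.measurable.aemeasurable]
    exact hf.cov_eq z z'

lemma IsGPPrior.memLp_eval (hQ : IsGPPrior Q (fun h => h) k) (z : S) :
    MemLp (fun h : C(S, ℝ) => h z) 2 Q :=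
  (hQ.gaussian.hasGaussianLaw_eval z).memLp_two

lemma IsGPPrior.isProbabilityMeasure (hQ : IsGPPrior Q (fun h => h) k) : IsProbabilityMeasure Q :=
  hQ.gaussian.isProbabilityMeasure

lemma IsGPPrior.kernel_eq_integral (hQ : IsGPPrior Q (fun h => h) k) (z z' : S) :
    k z z' = ∫ h, h z * h z' ∂Q := by
  have := hQ.isProbabilityMeasure
  rw [← hQ.cov_eq z z', covariance_eq_sub (hQ.memLp_eval z) (hQ.memLp_eval z'), hQ.mean_eq]
  simp

lemma IsGPPrior.kernel_symm (hQ : IsGPPrior Q (fun h => h) k) (z z' : S) : k z z' = k z' z := by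
  rw [← hQ.cov_eq z z', covariance_comm, hQ.cov_eq]

lemma IsGPPrior.ae_eval_eq_zero (hQ : IsGPPrior Q (fun h => h) k) {z : S} (hz : k z z = 0) :
    ∀ᵐ h ∂Q, h z = 0 := by
  have h1 : ∫ h, h z ^ 2 ∂Q = 0 := by
    simp_rw [sq]
    rw [← hQ.kernel_eq_integral, hz]
  rw [integral_eq_zero_iff_of_nonneg (fun h => sq_nonneg _) (hQ.memLp_eval z).integrable_sq] at h1
  filter_upwards [h1] with h hh
  simpa using hh

lemma IsGPPrior.kernel_eq_zero (hQ : IsGPPrior Q (fun h => h) k) {z : S} (hz : k z z = 0)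
    (z' : S) : k z z' = 0 := by
  rw [hQ.kernel_eq_integral, integral_eq_zero_of_ae]
  filter_upwards [hQ.ae_eval_eq_zero hz] with h hh
  simp [hh]

/-- The kernel is positive semidefinite. -/
lemma IsGPPrior.kernel_quadratic_nonneg {ι : Type*} [Fintype ι]
    (hQ : IsGPPrior Q (fun h => h) k) (a : ι → S) (w : ι → ℝ) :
    0 ≤ ∑ i, ∑ j, w i * w j * k (a i) (a j) := by
  have h1 : ∑ i, ∑ j, w i * w j * k (a i) (a j) = ∫ h, (∑ i, w i * h (a i)) ^ 2 ∂Q := by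
    have hint (i j : ι) : Integrable (fun h : C(S, ℝ) => w i * w j * (h (a i) * h (a j))) Q :=
      ((hQ.memLp_eval _).integrable_mul (hQ.memLp_eval _)).const_mul _
    have h2 (h : C(S, ℝ)) : (∑ i, w i * h (a i)) ^ 2 =
        ∑ i, ∑ j, w i * w j * (h (a i) * h (a j)) := by
      rw [sq, Finset.sum_mul_sum]
      exact Finset.sum_congr rfl fun i _ => Finset.sum_congr rfl fun j _ => by ring
    simp_rw [h2]
    rw [integral_finsetSum _ fun i _ => integrable_finsetSum _ fun j _ => hint i j]
    refine Finset.sum_congr rfl fun i _ => ?_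
    rw [integral_finsetSum _ fun j _ => hint i j]
    refine Finset.sum_congr rfl fun j _ => ?_
    rw [integral_const_mul, ← hQ.kernel_eq_integral]
  rw [h1]
  exact integral_nonneg fun h => sq_nonneg _

end Eval

section ContinuousPaths

variable {S : Type*} [MetricSpace S] [CompactSpace S] [Nonempty S] {Q : Measure C(S, ℝ)}
  {k : S → S → ℝ}

/-- Measures on pairs of continuous functions are determined by the values of the two functions. -/
lemma measure_prod_ext {μ ν : Measure (C(S, ℝ) × C(S, ℝ))}
    (h : μ.map (fun p (t : S ⊕ S) => Sum.elim (fun s => p.1 s) (fun s => p.2 s) t) =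
      ν.map (fun p (t : S ⊕ S) => Sum.elim (fun s => p.1 s) (fun s => p.2 s) t)) : μ = ν := by
  let d := TopologicalSpace.denseSeq S
  let r : (S ⊕ S → ℝ) → (ℕ ⊕ ℕ → ℝ) := fun x t => x (Sum.map d d t)
  let F : C(S, ℝ) × C(S, ℝ) → (S ⊕ S → ℝ) :=
    fun p t => Sum.elim (fun s => p.1 s) (fun s => p.2 s) t
  have hF : Measurable F := by
    refine measurable_pi_lambda _ fun t => ?_
    rcases t with s | s
    · exact (measurable_eval s).comp measurable_fst
    · exact (measurable_eval s).comp measurable_snd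
  have hr : Measurable r := by fun_prop
  have hinj : Function.Injective (r ∘ F) := by
    intro p q hpq
    have h1 : (p.1 : S → ℝ) ∘ d = q.1 ∘ d := by
      ext i; exact congrFun hpq (Sum.inl i)
    have h2 : (p.2 : S → ℝ) ∘ d = q.2 ∘ d := by
      ext i; exact congrFun hpq (Sum.inr i)
    have hd := TopologicalSpace.denseRange_denseSeq S
    exact Prod.ext (DFunLike.coe_injective (hd.equalizer p.1.continuous q.1.continuous h1))
      (DFunLike.coe_injective (hd.equalizer p.2.continuous q.2.continuous h2))
  have hemb : MeasurableEmbedding (r ∘ F) := (hr.comp hF).measurableEmbedding hinj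
  have h3 : μ.map (r ∘ F) = ν.map (r ∘ F) := by
    rw [← Measure.map_map hr hF, ← Measure.map_map hr hF]
    exact congrArg _ h
  rw [← hemb.comap_map μ, ← hemb.comap_map ν, h3]

/-- A centred Gaussian measure on path space satisfies the hypothesis of Fernique's theorem,
because its finite-dimensional marginals do. -/
lemma IsGPPrior.map_rotation_eq_self (hQ : IsGPPrior Q (fun h => h) k) (θ : ℝ) :
    (Q.prod Q).map (ContinuousLinearMap.rotation θ) = Q.prod Q := by
  classical
  have := hQ.isProbabilityMeasure
  have hval (t : S ⊕ S) : Measurable (fun p : C(S, ℝ) × C(S, ℝ) =>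
      Sum.elim (fun s => p.1 s) (fun s => p.2 s) t) := by
    rcases t with s | s
    · exact (measurable_eval s).comp measurable_fst
    · exact (measurable_eval s).comp measurable_snd
  have hrot : Measurable (ContinuousLinearMap.rotation (E := C(S, ℝ)) θ) :=
    (ContinuousLinearMap.continuous _).measurable
  apply measure_prod_ext
  rw [Measure.map_map (measurable_pi_lambda _ hval) hrot]
  refine (map_eq_iff_forall_finset_map_restrict_eq
    (X := fun (t : S ⊕ S) (p : C(S, ℝ) × C(S, ℝ)) => Sum.elim
      (fun s => (ContinuousLinearMap.rotation θ p).1 s)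
      (fun s => (ContinuousLinearMap.rotation θ p).2 s) t)
    (Y := fun (t : S ⊕ S) (p : C(S, ℝ) × C(S, ℝ)) =>
      Sum.elim (fun s => p.1 s) (fun s => p.2 s) t)
    (measurable_pi_lambda _ fun t => (hval t).comp hrot).aemeasurable
    (measurable_pi_lambda _ hval).aemeasurable).2 fun I => ?_
  -- the points at which one of the two functions is evaluated
  let J : Finset S := I.image (Sum.elim id id)
  let ev : C(S, ℝ) → (J → ℝ) := fun h => J.restrict (fun s => h s)
  have hev : Measurable ev := measurable_pi_lambda _ fun i => measurable_eval _
  let G : (J → ℝ) × (J → ℝ) → (I → ℝ) := fun q i =>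
    if (i : S ⊕ S).isLeft then q.1 ⟨Sum.elim id id i.1, Finset.mem_image_of_mem _ i.2⟩
    else q.2 ⟨Sum.elim id id i.1, Finset.mem_image_of_mem _ i.2⟩
  have hG : Measurable G := by
    refine measurable_pi_lambda _ fun i => ?_
    by_cases hi : (i : S ⊕ S).isLeft <;>
      simp only [G, hi, if_true, Bool.false_eq_true, if_false] <;> fun_prop
  have hgauss : IsGaussian (Q.map ev) := (hQ.gaussian.hasGaussianLaw J).isGaussian_map
  have hcent (L : StrongDual ℝ (J → ℝ)) : (Q.map ev)[L] = 0 := by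
    rw [ContinuousLinearMap.integral_comp_comm L (φ := fun x => x) IsGaussian.integrable_id]
    have h0 : ∫ x, x ∂(Q.map ev) = 0 := by
      ext i
      rw [integral_map hev.aemeasurable (by fun_prop), eval_integral]
      · exact hQ.mean_eq _
      · exact fun j => (hQ.memLp_eval _).integrable (by norm_num)
    rw [h0, map_zero]
  have hinv := IsGaussian.map_rotation_eq_self_of_forall_strongDual_eq_zero hcent θ
  have hrotJ : Measurable (ContinuousLinearMap.rotation (E := J → ℝ) θ) :=
    (ContinuousLinearMap.continuous _).measurable
  have hmap : (Q.prod Q).map (Prod.map ev ev) = (Q.map ev).prod (Q.map ev) :=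
    (Measure.map_prod_map Q Q hev hev).symm
  have h1 : (fun p : C(S, ℝ) × C(S, ℝ) => I.restrict
      (fun t => Sum.elim (fun s => p.1 s) (fun s => p.2 s) t)) = G ∘ Prod.map ev ev := by
    ext p ⟨i, hi⟩
    rcases i with s | s <;> simp [G, ev]
  have h2 : (fun p : C(S, ℝ) × C(S, ℝ) => I.restrict (fun t => Sum.elim
      (fun s => (ContinuousLinearMap.rotation θ p).1 s)
      (fun s => (ContinuousLinearMap.rotation θ p).2 s) t)) =
      G ∘ ContinuousLinearMap.rotation θ ∘ Prod.map ev ev := by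
    ext p ⟨i, hi⟩
    rcases i with s | s <;> simp [G, ev, ContinuousLinearMap.rotation_apply]
  rw [h1, h2, ← Measure.map_map hG (hrotJ.comp (hev.prodMap hev)),
    ← Measure.map_map hrotJ (hev.prodMap hev), ← Measure.map_map hG (hev.prodMap hev), hmap, hinv]

lemma IsGPPrior.integrable_norm_sq (hQ : IsGPPrior Q (fun h => h) k) :
    Integrable (fun h : C(S, ℝ) => ‖h‖ ^ 2) Q := by
  have := hQ.isProbabilityMeasure
  obtain ⟨C, hC, hint⟩ :=
    exists_integrable_exp_sq_of_map_rotation_eq_self (hQ.map_rotation_eq_self _)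
  refine Integrable.mono' (hint.const_mul C⁻¹) (by fun_prop) (ae_of_all _ fun h => ?_)
  rw [Real.norm_of_nonneg (by positivity), ← div_eq_inv_mul, le_div_iff₀ hC, mul_comm]
  linarith [Real.add_one_le_exp (C * ‖h‖ ^ 2)]

lemma IsGPPrior.integrable_norm (hQ : IsGPPrior Q (fun h => h) k) :
    Integrable (fun h : C(S, ℝ) => ‖h‖) Q := by
  have := hQ.isProbabilityMeasure
  refine Integrable.mono' ((integrable_const 1).add hQ.integrable_norm_sq) (by fun_prop)
    (ae_of_all _ fun h => ?_)
  simp only [norm_norm, Pi.add_apply]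
  nlinarith [sq_nonneg (‖h‖ - 1)]

/-- A kernel that admits a Gaussian process with continuous paths is continuous. -/
lemma IsGPPrior.continuous_kernel (hQ : IsGPPrior Q (fun h => h) k) :
    Continuous (fun p : S × S => k p.1 p.2) := by
  simp_rw [hQ.kernel_eq_integral]
  refine continuous_of_dominated (bound := fun h => ‖h‖ ^ 2)
    (fun p => ((measurable_eval p.1).mul (measurable_eval p.2)).aestronglyMeasurable)
    (fun p => ae_of_all _ fun h => ?_) hQ.integrable_norm_sq (ae_of_all _ fun h => by fun_prop)
  rw [norm_mul, sq]
  exact mul_le_mul (h.norm_coe_le_norm _) (h.norm_coe_le_norm _) (norm_nonneg _) (norm_nonneg _)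

/-- A centred Gaussian process with continuous paths and zero variance vanishes identically. -/
lemma IsGPPrior.ae_eq_zero (hQ : IsGPPrior Q (fun h => h) k) (hk : ∀ z, k z z = 0) :
    ∀ᵐ h ∂Q, h = 0 := by
  have h1 : ∀ᵐ h ∂Q, ∀ n, h (TopologicalSpace.denseSeq S n) = 0 :=
    ae_all_iff.2 fun n => hQ.ae_eval_eq_zero (hk _)
  filter_upwards [h1] with h hh
  refine DFunLike.coe_injective ((TopologicalSpace.denseRange_denseSeq S).equalizer
    h.continuous continuous_const ?_)
  ext n
  exact hh n

end ContinuousPaths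

/-! ### Linear algebra of the regularized kernel matrix -/

section Matrix

open Matrix

variable {S : Type*} {v : ℝ} {n : ℕ}

lemma regKernelMatrix_apply (k : S → S → ℝ) (v : ℝ) (a : Fin n → S) (i j : Fin n) :
    regKernelMatrix k v a i j = k (a i) (a j) + if i = j then v else 0 := by
  simp [regKernelMatrix, Matrix.one_apply]

lemma dotProduct_regKernelMatrix (k : S → S → ℝ) (v : ℝ) (a : Fin n → S) (w : Fin n → ℝ) :
    w ⬝ᵥ regKernelMatrix k v a *ᵥ w =
      ∑ i, ∑ j, w i * w j * k (a i) (a j) + v * (w ⬝ᵥ w) := by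
  rw [regKernelMatrix, add_mulVec, dotProduct_add, smul_mulVec, one_mulVec, dotProduct_smul,
    smul_eq_mul]
  congr 1
  simp only [dotProduct, mulVec, of_apply, Finset.mul_sum]
  exact Finset.sum_congr rfl fun i _ => Finset.sum_congr rfl fun j _ => by ring

variable [TopologicalSpace S] {Q : Measure C(S, ℝ)}
  {k : S → S → ℝ}

lemma IsGPPrior.posDef (hQ : IsGPPrior Q (fun h => h) k) (hv : 0 < v) (a : Fin n → S) :
    (regKernelMatrix k v a).PosDef := by
  refine PosDef.of_dotProduct_mulVec_pos ?_ fun w hw => ?_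
  · ext i j
    simp [regKernelMatrix_apply, hQ.kernel_symm (a i), eq_comm]
  · rw [star_trivial, dotProduct_regKernelMatrix]
    have h1 := hQ.kernel_quadratic_nonneg a w
    have h2 : 0 < w ⬝ᵥ w := by
      have := dotProduct_star_self_pos_iff.2 hw
      simpa using this
    positivity

/-- The posterior variance is the mean squared error of the posterior mean: a sum of the variance
of a linear combination of values of the process and of the variance of the averaged noise. -/
lemma IsGPPrior.exists_posteriorVar_eq (hQ : IsGPPrior Q (fun h => h) k) (hv : 0 < v)
    (d : Fin n → S × ℝ) (z : S) : ∃ w : Fin n → ℝ,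
      (fun i => k z (d i).1) = regKernelMatrix k v (fun i => (d i).1) *ᵥ w ∧
      ∃ r, 0 ≤ r ∧ posteriorVar k v d z = r + v * (w ⬝ᵥ w) := by
  set a := fun i => (d i).1 with ha
  set M := regKernelMatrix k v a
  have hM := hQ.posDef hv a
  have hdet : IsUnit M.det := (Matrix.isUnit_iff_isUnit_det _).1 hM.isUnit
  set b : Fin n → ℝ := fun i => k z (a i) with hb
  refine ⟨M⁻¹ *ᵥ b, ?_, ?_⟩
  · rw [mulVec_mulVec, mul_nonsing_inv _ hdet, one_mulVec]
  · set w := M⁻¹ *ᵥ b with hw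
    have hMw : M *ᵥ w = b := by rw [hw, mulVec_mulVec, mul_nonsing_inv _ hdet, one_mulVec]
    have h1 := hQ.kernel_quadratic_nonneg (fun i : Option (Fin n) => i.elim z a)
      (fun i => i.elim 1 (fun j => - w j))
    refine ⟨_, h1, ?_⟩
    have h2 := dotProduct_regKernelMatrix k v a w
    rw [show regKernelMatrix k v a = M from rfl, hMw] at h2
    have h3 : posteriorVar k v d z = k z z - b ⬝ᵥ w := rfl
    have h4 : b ⬝ᵥ w = ∑ i, w i * k z (a i) := by
      simp [dotProduct, hb, mul_comm]
    rw [dotProduct_comm, h4] at h2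
    rw [h3, h4]
    simp only [Fintype.sum_option, Option.elim, Finset.sum_add_distrib, neg_mul, mul_neg, one_mul,
      mul_one, Finset.sum_neg_distrib]
    simp only [hQ.kernel_symm _ z]
    linarith

lemma IsGPPrior.posteriorVar_nonneg (hQ : IsGPPrior Q (fun h => h) k) (hv : 0 < v)
    (d : Fin n → S × ℝ) (z : S) : 0 ≤ posteriorVar k v d z := by
  obtain ⟨w, -, r, hr, h⟩ := hQ.exists_posteriorVar_eq hv d z
  rw [h]
  have : 0 ≤ w ⬝ᵥ w := by simpa using dotProduct_star_self_nonneg w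
  positivity

/-- Noisy observations never determine a value that is not deterministic from the start. -/
lemma IsGPPrior.kernel_self_eq_zero_of_posteriorVar (hQ : IsGPPrior Q (fun h => h) k)
    (hv : 0 < v) (d : Fin n → S × ℝ) (z : S) (h0 : posteriorVar k v d z = 0) : k z z = 0 := by
  obtain ⟨w, hw, r, hr, h⟩ := hQ.exists_posteriorVar_eq hv d z
  have hnn : 0 ≤ w ⬝ᵥ w := by simpa using dotProduct_star_self_nonneg w
  have h1 : w ⬝ᵥ w = 0 := by nlinarith [mul_nonneg hv.le hnn]
  have h2 : w = 0 := dotProduct_self_eq_zero.1 h1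
  rw [posteriorVar, hw, h2] at h0
  simpa using h0

lemma IsGPPrior.posteriorVar_le (hQ : IsGPPrior Q (fun h => h) k) (hv : 0 < v)
    (d : Fin n → S × ℝ) (z : S) : posteriorVar k v d z ≤ k z z := by
  have h := (hQ.posDef hv (fun i => (d i).1)).inv.posSemidef.dotProduct_mulVec_nonneg
    (fun i => k z (d i).1)
  rw [star_trivial] at h
  rw [posteriorVar]
  linarith

/-- Adding an observation multiplies the determinant of the covariance matrix of the observations
by the predictive variance of the new observation. -/
lemma IsGPPrior.det_succ (hQ : IsGPPrior Q (fun h => h) k) (hv : 0 < v)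
    (d : Fin (n + 1) → S × ℝ) :
    (regKernelMatrix k v (fun i => (d i).1)).det =
      (regKernelMatrix k v (fun i : Fin n => (d i.castSucc).1)).det *
        (v + posteriorVar k v (fun i : Fin n => d i.castSucc) (d (Fin.last n)).1) := by
  set M := regKernelMatrix k v (fun i : Fin n => (d i.castSucc).1) with hM
  have hdet : IsUnit M.det :=
    (Matrix.isUnit_iff_isUnit_det _).1 (hQ.posDef hv fun i : Fin n => (d i.castSucc).1).isUnit
  let _ := M.invertibleOfIsUnitDet hdet
  set z := (d (Fin.last n)).1 with hz
  set b : Fin n → ℝ := fun i => k z (d i.castSucc).1 with hb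
  have hblock : (regKernelMatrix k v (fun i => (d i).1)).submatrix finSumFinEquiv finSumFinEquiv =
      fromBlocks M (Matrix.of fun i (_ : Fin 1) => b i) (Matrix.of fun (_ : Fin 1) i => b i)
        (Matrix.of fun _ _ => k z z + v) := by
    ext i j
    rcases i with i | i <;> rcases j with j | j
    · simp [hM, regKernelMatrix_apply, Fin.castAdd, Fin.castSucc]
    · obtain rfl := Subsingleton.elim j 0
      have h1 : finSumFinEquiv (Sum.inl i) = i.castSucc := rfl
      have h2 : (finSumFinEquiv (Sum.inr 0) : Fin (n + 1)) = Fin.last n := rfl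
      rw [submatrix_apply, h1, h2, regKernelMatrix_apply, if_neg (Fin.castSucc_ne_last i), add_zero,
        hQ.kernel_symm]
      rfl
    · obtain rfl := Subsingleton.elim i 0
      have h1 : finSumFinEquiv (Sum.inl j) = j.castSucc := rfl
      have h2 : (finSumFinEquiv (Sum.inr 0) : Fin (n + 1)) = Fin.last n := rfl
      rw [submatrix_apply, h1, h2, regKernelMatrix_apply, if_neg (Fin.castSucc_ne_last j).symm,
        add_zero]
      rfl
    · obtain rfl := Subsingleton.elim i 0
      obtain rfl := Subsingleton.elim j 0
      have h2 : (finSumFinEquiv (Sum.inr 0) : Fin (n + 1)) = Fin.last n := rfl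
      rw [submatrix_apply, h2, regKernelMatrix_apply, if_pos rfl]
      rfl
  rw [← det_submatrix_equiv_self finSumFinEquiv, hblock, det_fromBlocks₁₁]
  congr 1
  rw [det_unique, posteriorVar, invOf_eq_nonsing_inv, Matrix.mul_assoc]
  change k z z + v - b ⬝ᵥ M⁻¹ *ᵥ b = v + (k z z - b ⬝ᵥ M⁻¹ *ᵥ b)
  ring

end Matrix

/-! ### Gaussian likelihoods -/

section Likelihood

variable {ι : Type*} [Fintype ι]

lemma continuous_gaussianPDFReal (v : ℝ≥0) :
    Continuous (fun p : ℝ × ℝ => gaussianPDFReal p.1 v p.2) := by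
  simp only [gaussianPDFReal]
  fun_prop

lemma gaussianPDFReal_le (m : ℝ) (v : ℝ≥0) (y : ℝ) :
    gaussianPDFReal m v y ≤ (√(2 * Real.pi * v))⁻¹ := by
  rw [gaussianPDFReal]
  refine mul_le_of_le_one_right (by positivity) (Real.exp_le_one_iff.2 ?_)
  rw [neg_div]
  exact neg_nonpos.2 (by positivity)

/-- The density at `y` of independent Gaussian variables with means `m i` and common variance
`v`. -/
noncomputable def gaussianLikelihood (v : ℝ≥0) (m y : ι → ℝ) : ℝ :=
  ∏ i, gaussianPDFReal (m i) v (y i)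

lemma gaussianLikelihood_nonneg (v : ℝ≥0) (m y : ι → ℝ) : 0 ≤ gaussianLikelihood v m y :=
  Finset.prod_nonneg fun _ _ => gaussianPDFReal_nonneg _ _ _

lemma gaussianLikelihood_pos {v : ℝ≥0} (hv : v ≠ 0) (m y : ι → ℝ) :
    0 < gaussianLikelihood v m y :=
  Finset.prod_pos fun _ _ => gaussianPDFReal_pos _ _ _ hv

lemma gaussianLikelihood_le (v : ℝ≥0) (m y : ι → ℝ) :
    gaussianLikelihood v m y ≤ (√(2 * Real.pi * v))⁻¹ ^ Fintype.card ι :=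
  (Finset.prod_le_prod (fun _ _ => gaussianPDFReal_nonneg _ _ _)
    fun _ _ => gaussianPDFReal_le _ _ _).trans_eq (by simp)

lemma continuous_gaussianLikelihood {X : Type*} [TopologicalSpace X] (v : ℝ≥0)
    {m y : X → ι → ℝ} (hm : Continuous m) (hy : Continuous y) :
    Continuous (fun x => gaussianLikelihood v (m x) (y x)) := by
  refine continuous_finsetProd _ fun i _ => ?_
  have h : Continuous (fun x => (m x i, y x i)) := by fun_prop
  exact (continuous_gaussianPDFReal v).comp h

lemma measurable_gaussianLikelihood {X : Type*} [MeasurableSpace X] (v : ℝ≥0)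
    {m y : X → ι → ℝ} (hm : Measurable m) (hy : Measurable y) :
    Measurable (fun x => gaussianLikelihood v (m x) (y x)) := by
  unfold gaussianLikelihood
  refine Finset.measurable_fun_prod _ fun i _ => ?_
  have h1 : Measurable (fun p : ℝ × ℝ => gaussianPDFReal p.1 v p.2) :=
    (continuous_gaussianPDFReal v).measurable
  have h : Measurable (fun x => (m x i, y x i)) := by fun_prop
  exact Measurable.comp (g := fun p : ℝ × ℝ => gaussianPDFReal p.1 v p.2)
    (f := fun x => (m x i, y x i)) h1 h

lemma pi_gaussianReal_eq_withDensity {v : ℝ≥0} (hv : v ≠ 0) (m : ι → ℝ) :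
    Measure.pi (fun i => gaussianReal (m i) v) =
      volume.withDensity (fun y => ENNReal.ofReal (gaussianLikelihood v m y)) := by
  refine Measure.pi_eq fun s hs => ?_
  rw [withDensity_apply _ (MeasurableSet.univ_pi hs), ← lintegral_indicator
    (MeasurableSet.univ_pi hs)]
  have h1 (y : ι → ℝ) : (Set.univ.pi s).indicator
      (fun y => ENNReal.ofReal (gaussianLikelihood v m y)) y =
      ENNReal.ofReal (∏ i, (s i).indicator (gaussianPDFReal (m i) v) (y i)) := by
    by_cases hy : y ∈ Set.univ.pi s
    · rw [Set.indicator_of_mem hy, gaussianLikelihood]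
      congr 1
      exact Finset.prod_congr rfl fun i _ => (Set.indicator_of_mem (hy i trivial) _).symm
    · rw [Set.indicator_of_notMem hy]
      simp only [Set.mem_pi, Set.mem_univ, true_imp_iff, not_forall] at hy
      obtain ⟨i, hi⟩ := hy
      rw [Finset.prod_eq_zero (Finset.mem_univ i) (Set.indicator_of_notMem hi _),
        ENNReal.ofReal_zero]
  have hnn (i : ι) (x : ℝ) : 0 ≤ (s i).indicator (gaussianPDFReal (m i) v) x :=
    Set.indicator_nonneg (fun _ _ => gaussianPDFReal_nonneg _ _ _) _
  simp_rw [h1]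
  rw [← ofReal_integral_eq_lintegral_ofReal, volume_pi,
    integral_fintype_prod_eq_prod (fun i => (s i).indicator (gaussianPDFReal (m i) v)),
    ENNReal.ofReal_prod_of_nonneg fun i _ => integral_nonneg (hnn i)]
  · refine Finset.prod_congr rfl fun i _ => ?_
    rw [gaussianReal_apply_eq_integral _ hv, integral_indicator (hs i)]
  · exact Integrable.fintype_prod fun i => (integrable_gaussianPDFReal _ _).indicator (hs i)
  · exact ae_of_all _ fun y => Finset.prod_nonneg fun i _ => hnn i _

lemma map_add_pi_gaussianReal (v : ℝ≥0) (m : ι → ℝ) :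
    (Measure.pi fun _ : ι => gaussianReal 0 v).map (fun e => m + e) =
      Measure.pi (fun i => gaussianReal (m i) v) := by
  have h := Measure.pi_map_pi (μ := fun _ : ι => gaussianReal 0 v) (f := fun i x => m i + x)
    (fun i => by fun_prop)
  simp only [gaussianReal_map_const_add, zero_add] at h
  exact h

lemma lintegral_gaussian_noise {v : ℝ≥0} (hv : v ≠ 0) (m : ι → ℝ) {F : (ι → ℝ) → ℝ≥0∞}
    (hF : Measurable F) :
    ∫⁻ e, F (m + e) ∂(Measure.pi fun _ : ι => gaussianReal 0 v) =
      ∫⁻ y, ENNReal.ofReal (gaussianLikelihood v m y) * F y := by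
  rw [← lintegral_map hF (by fun_prop), map_add_pi_gaussianReal,
    pi_gaussianReal_eq_withDensity hv, lintegral_withDensity_eq_lintegral_mul _ _ hF]
  · rfl
  · exact (measurable_gaussianLikelihood v measurable_const measurable_id).ennreal_ofReal

end Likelihood

/-! ### Observations at fixed inputs -/

section FixedDesign

open Matrix

variable {S : Type*} [TopologicalSpace S] {Q : Measure C(S, ℝ)} {k : S → S → ℝ} {v : ℝ≥0} {n : ℕ}

/-- The joint law of a random function and of the noise of `n` observations. -/
noncomputable abbrev noisyLaw (Q : Measure C(S, ℝ)) (v : ℝ≥0) (n : ℕ) :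
    Measure (C(S, ℝ) × (Fin n → ℝ)) :=
  Q.prod (Measure.pi fun _ : Fin n => gaussianReal 0 v)

/-- The noisy observations at the inputs `a`. -/
def obs (a : Fin n → S) (p : C(S, ℝ) × (Fin n → ℝ)) : Fin n → ℝ := fun i => p.1 (a i) + p.2 i

lemma measurable_evals (a : Fin n → S) : Measurable (fun (h : C(S, ℝ)) i => h (a i)) :=
  measurable_pi_lambda _ fun _ => measurable_eval _

lemma measurable_obs (a : Fin n → S) : Measurable (obs a) :=
  measurable_pi_lambda _ fun i =>
    ((measurable_eval (a i)).comp measurable_fst).add (by fun_prop)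

lemma measurable_likelihood_evals (v : ℝ≥0) (a : Fin n → S) :
    Measurable (fun p : C(S, ℝ) × (Fin n → ℝ) => gaussianLikelihood v (fun i => p.1 (a i)) p.2) :=
  measurable_gaussianLikelihood v ((measurable_evals a).comp measurable_fst) measurable_snd

/-- The joint law of the function and of its noisy observations has the likelihood as density. -/
lemma map_noisyLaw_obs [SFinite Q] (hv : v ≠ 0) (a : Fin n → S) :
    (noisyLaw Q v n).map (fun p => (p.1, obs a p)) =
      (Q.prod volume).withDensity
        (fun p => ENNReal.ofReal (gaussianLikelihood v (fun i => p.1 (a i)) p.2)) := by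
  have hL := (measurable_likelihood_evals v a).ennreal_ofReal
  refine Measure.ext_of_lintegral _ fun F hF => ?_
  rw [lintegral_map hF (measurable_fst.prodMk (measurable_obs a)),
    lintegral_withDensity_eq_lintegral_mul _ hL hF, lintegral_prod _ (by
      exact (hF.comp (measurable_fst.prodMk (measurable_obs a))).aemeasurable),
    lintegral_prod _ (hL.mul hF).aemeasurable]
  refine lintegral_congr fun h => ?_
  exact lintegral_gaussian_noise hv (fun i => h (a i)) (F := fun y => F (h, y))
    (hF.comp (by fun_prop))

/-- A value of the process and its noisy observations are jointly Gaussian. -/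
lemma IsGPPrior.hasGaussianLaw_obs (hQ : IsGPPrior Q (fun h => h) k) (v : ℝ≥0)
    (a : Fin n → S) (z : S) :
    HasGaussianLaw (fun p : C(S, ℝ) × (Fin n → ℝ) => (p.1 z, obs a p)) (noisyLaw Q v n) := by
  have := hQ.isProbabilityMeasure
  have h1 : HasGaussianLaw (fun p : C(S, ℝ) × (Fin n → ℝ) =>
      fun t : Option (Fin n) => p.1 (t.elim z a)) (noisyLaw Q v n) := by
    have hm : Measurable (fun (h : C(S, ℝ)) (t : Option (Fin n)) => h (t.elim z a)) :=
      measurable_pi_lambda _ fun _ => measurable_eval _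
    have h := (hasGaussianLaw_comp hQ.gaussian
      (fun t : Option (Fin n) => t.elim z a)).isGaussian_map
    refine ⟨?_⟩
    have h2 : (noisyLaw Q v n).map Prod.fst = Q := by
      simp [noisyLaw, Measure.map_fst_prod]
    rw [← h2, Measure.map_map hm measurable_fst] at h
    exact h
  have h2 : HasGaussianLaw (fun p : C(S, ℝ) × (Fin n → ℝ) => p.2) (noisyLaw Q v n) := by
    refine ⟨?_⟩
    have h3 : (noisyLaw Q v n).map (fun p => p.2) =
        Measure.pi fun _ : Fin n => gaussianReal 0 v := by
      simp [noisyLaw, Measure.map_snd_prod]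
    rw [h3]
    have h4 : iIndepFun (fun (i : Fin n) (e : Fin n → ℝ) => e i)
        (Measure.pi fun _ : Fin n => gaussianReal 0 v) :=
      iIndepFun_pi (X := fun _ => id) (fun _ => aemeasurable_id)
    have h5 := (h4.hasGaussianLaw fun i => ⟨by
      have := (measurePreserving_eval (fun _ : Fin n => gaussianReal 0 v) i).map_eq
      change IsGaussian (Measure.map (Function.eval (β := fun _ : Fin n => ℝ) i) _)
      rw [this]
      infer_instance⟩).isGaussian_map
    simpa using h5
  have h3 : IndepFun (fun p : C(S, ℝ) × (Fin n → ℝ) =>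
      fun t : Option (Fin n) => p.1 (t.elim z a)) (fun p => p.2) (noisyLaw Q v n) :=
    indepFun_prod (X := fun (h : C(S, ℝ)) (t : Option (Fin n)) => h (t.elim z a)) (Y := id)
      (measurable_pi_lambda _ fun _ => measurable_eval _) measurable_id
  let L : (Option (Fin n) → ℝ) × (Fin n → ℝ) →L[ℝ] ℝ × (Fin n → ℝ) :=
    { toFun x := (x.1 none, fun i => x.1 (some i) + x.2 i)
      map_add' x y := by ext <;> simp; ring
      map_smul' c x := by ext <;> simp; ring }
  exact (h3.hasGaussianLaw h1 h2).map L

end FixedDesign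

/-! ### Moments of the observations and the error of the posterior mean -/

section FixedDesignMoments

open Matrix

variable {S : Type*} [TopologicalSpace S] {Q : Measure C(S, ℝ)} {k : S → S → ℝ} {v : ℝ≥0} {n : ℕ}

lemma covariance_eval_noisyLaw (hQ : IsGPPrior Q (fun h => h) k) (v : ℝ≥0) (z z' : S) :
    cov[fun p => p.1 z, fun p => p.1 z'; noisyLaw Q v n] = k z z' := by
  have := hQ.isProbabilityMeasure
  have h2 : (noisyLaw Q v n).map Prod.fst = Q := by simp [noisyLaw, Measure.map_fst_prod]
  rw [← hQ.cov_eq z z']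
  conv_rhs => rw [← h2]
  rw [covariance_map (measurable_eval z).aestronglyMeasurable
    (measurable_eval z').aestronglyMeasurable measurable_fst.aemeasurable]
  rfl

lemma covariance_noise_noisyLaw [IsProbabilityMeasure Q] (v : ℝ≥0) (i j : Fin n) :
    cov[fun p => p.2 i, fun p => p.2 j; noisyLaw Q v n] = if i = j then (v : ℝ) else 0 := by
  have h2 : (noisyLaw Q v n).map Prod.snd = Measure.pi fun _ : Fin n => gaussianReal 0 v := by
    simp [noisyLaw, Measure.map_snd_prod]
  have h3 : cov[fun p => p.2 i, fun p => p.2 j; noisyLaw Q v n] =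
      cov[fun e => e i, fun e => e j; Measure.pi fun _ : Fin n => gaussianReal 0 v] := by
    rw [← h2, covariance_map (measurable_pi_apply i).aestronglyMeasurable
      (measurable_pi_apply j).aestronglyMeasurable measurable_snd.aemeasurable]
    rfl
  rw [h3]
  have h4 : iIndepFun (fun (i : Fin n) (e : Fin n → ℝ) => e i)
      (Measure.pi fun _ : Fin n => gaussianReal 0 v) :=
    iIndepFun_pi (X := fun _ => id) (fun _ => aemeasurable_id)
  have hmap (i : Fin n) : (Measure.pi fun _ : Fin n => gaussianReal 0 v).map (fun e => e i) =
      gaussianReal 0 v := (measurePreserving_eval (fun _ : Fin n => gaussianReal 0 v) i).map_eq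
  have hmeas (i : Fin n) : Measurable (fun e : Fin n → ℝ => e i) := measurable_pi_apply i
  have hmem (i : Fin n) : MemLp (fun e : Fin n → ℝ => e i) 2
      (Measure.pi fun _ : Fin n => gaussianReal 0 v) := by
    have h5 := memLp_id_gaussianReal' (μ := 0) (v := v) 2 (by norm_num)
    rw [← hmap i] at h5
    exact (memLp_map_measure_iff aestronglyMeasurable_id (hmeas i).aemeasurable).1 h5
  split_ifs with hij
  · subst hij
    rw [covariance_self (measurable_pi_apply i).aemeasurable]
    have h6 := variance_id_gaussianReal (μ := 0) (v := v)
    rw [← hmap i, variance_map aemeasurable_id (hmeas i).aemeasurable] at h6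
    exact h6
  · exact (h4.indepFun hij).covariance_eq_zero (hmem i) (hmem j)

lemma indepFun_eval_noise [IsProbabilityMeasure Q] (v : ℝ≥0) (z : S) (i : Fin n) :
    IndepFun (fun p : C(S, ℝ) × (Fin n → ℝ) => p.1 z) (fun p => p.2 i) (noisyLaw Q v n) :=
  indepFun_prod (X := fun h : C(S, ℝ) => h z) (Y := fun e : Fin n → ℝ => e i)
    (measurable_eval z) (measurable_pi_apply i)

lemma memLp_eval_noisyLaw (hQ : IsGPPrior Q (fun h => h) k) (v : ℝ≥0) (z : S) :
    MemLp (fun p : C(S, ℝ) × (Fin n → ℝ) => p.1 z) 2 (noisyLaw Q v n) := by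
  have := hQ.isProbabilityMeasure
  exact (hQ.memLp_eval z).comp_measurePreserving measurePreserving_fst

lemma memLp_obs (hQ : IsGPPrior Q (fun h => h) k) (v : ℝ≥0) (a : Fin n → S) (i : Fin n) :
    MemLp (fun p => obs a p i) 2 (noisyLaw Q v n) :=
  ((hQ.hasGaussianLaw_obs v a (a i)).snd.eval i).memLp_two

lemma memLp_noise (hQ : IsGPPrior Q (fun h => h) k) (v : ℝ≥0) (a : Fin n → S) (i : Fin n) :
    MemLp (fun p : C(S, ℝ) × (Fin n → ℝ) => p.2 i) 2 (noisyLaw Q v n) := by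
  have h := (memLp_obs hQ v a i).sub (memLp_eval_noisyLaw hQ v (a i))
  refine h.congr_norm (by fun_prop) (ae_of_all _ fun p => ?_)
  simp [obs]

lemma covariance_eval_obs (hQ : IsGPPrior Q (fun h => h) k) (v : ℝ≥0) (a : Fin n → S) (z : S)
    (i : Fin n) : cov[fun p => p.1 z, fun p => obs a p i; noisyLaw Q v n] = k z (a i) := by
  have := hQ.isProbabilityMeasure
  change cov[fun p => p.1 z, (fun p => p.1 (a i)) + (fun p => p.2 i); noisyLaw Q v n] = _
  rw [covariance_add_right (memLp_eval_noisyLaw hQ v z) (memLp_eval_noisyLaw hQ v _)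
    (memLp_noise hQ v a i), covariance_eval_noisyLaw hQ,
    (indepFun_eval_noise v z i).covariance_eq_zero (memLp_eval_noisyLaw hQ v z)
      (memLp_noise hQ v a i), add_zero]

/-- The covariance matrix of the noisy observations. -/
lemma covariance_obs_obs (hQ : IsGPPrior Q (fun h => h) k) (v : ℝ≥0) (a : Fin n → S)
    (i j : Fin n) : cov[fun p => obs a p i, fun p => obs a p j; noisyLaw Q v n] =
      regKernelMatrix k v a i j := by
  have := hQ.isProbabilityMeasure
  change cov[(fun p => p.1 (a i)) + (fun p => p.2 i), fun p => obs a p j; noisyLaw Q v n] = _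
  rw [covariance_add_left (memLp_eval_noisyLaw hQ v _) (memLp_noise hQ v a i)
    (memLp_obs hQ v a j), covariance_eval_obs hQ, regKernelMatrix_apply]
  congr 1
  change cov[fun p => p.2 i, (fun p => p.1 (a j)) + (fun p => p.2 j); noisyLaw Q v n] = _
  rw [covariance_add_right (memLp_noise hQ v a i) (memLp_eval_noisyLaw hQ v _)
    (memLp_noise hQ v a j), covariance_noise_noisyLaw, covariance_comm,
    (indepFun_eval_noise v (a j) i).covariance_eq_zero (memLp_eval_noisyLaw hQ v _)
      (memLp_noise hQ v a i), zero_add]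

lemma integral_eval_noisyLaw (hQ : IsGPPrior Q (fun h => h) k) (v : ℝ≥0) (z : S) :
    ∫ p, p.1 z ∂(noisyLaw Q v n) = 0 := by
  have := hQ.isProbabilityMeasure
  rw [integral_fun_fst (fun h : C(S, ℝ) => h z), hQ.mean_eq, smul_zero]

lemma integral_obs (hQ : IsGPPrior Q (fun h => h) k) (v : ℝ≥0) (a : Fin n → S) (i : Fin n) :
    ∫ p, obs a p i ∂(noisyLaw Q v n) = 0 := by
  have := hQ.isProbabilityMeasure
  simp only [obs]
  rw [integral_add ((memLp_eval_noisyLaw hQ v _).integrable (by norm_num))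
    ((memLp_noise hQ v a i).integrable (by norm_num)), integral_eval_noisyLaw hQ, zero_add,
    integral_fun_snd (fun e : Fin n → ℝ => e i)]
  have h := integral_map (μ := Measure.pi fun _ : Fin n => gaussianReal 0 v)
    (measurable_pi_apply i).aemeasurable (f := fun x : ℝ => x) (by fun_prop)
  rw [(measurePreserving_eval (fun _ : Fin n => gaussianReal 0 v) i).map_eq,
    integral_id_gaussianReal] at h
  rw [← h, smul_zero]

/-- The posterior mean is a linear combination of the observations. -/
lemma posteriorMean_eq_dotProduct (hQ : IsGPPrior Q (fun h => h) k) (hv : v ≠ 0) (a : Fin n → S)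
    (y : Fin n → ℝ) (z : S) : posteriorMean k v (fun i => (a i, y i)) z =
      ((regKernelMatrix k v a)⁻¹ *ᵥ fun i => k z (a i)) ⬝ᵥ y := by
  have hM := (hQ.posDef (by positivity : 0 < (v : ℝ)) a).inv.isHermitian
  rw [posteriorMean, dotProduct_mulVec, ← mulVec_transpose]
  rw [IsHermitian, conjTranspose_eq_transpose_of_trivial] at hM
  rw [hM]

/-- The error of the posterior mean is independent of the observations. -/
lemma indepFun_residual_obs (hQ : IsGPPrior Q (fun h => h) k) (hv : v ≠ 0) (a : Fin n → S)
    (z : S) : IndepFun (fun p => p.1 z - posteriorMean k v (fun i => (a i, obs a p i)) z) (obs a)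
      (noisyLaw Q v n) := by
  have := hQ.isProbabilityMeasure
  set M := regKernelMatrix k v a with hM
  set w := M⁻¹ *ᵥ fun i => k z (a i) with hw
  have hpd := hQ.posDef (by positivity : 0 < (v : ℝ)) a
  have hdet : IsUnit M.det := (Matrix.isUnit_iff_isUnit_det _).1 hpd.isUnit
  simp_rw [posteriorMean_eq_dotProduct hQ hv]
  let L : ℝ × (Fin n → ℝ) →L[ℝ] (Fin 1 → ℝ) × (Fin n → ℝ) :=
    { toFun x := (fun _ => x.1 - w ⬝ᵥ x.2, x.2)
      map_add' x y := by ext <;> simp [dotProduct_add]; ring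
      map_smul' c x := by ext <;> simp; ring
      cont := by simp only [dotProduct]; fun_prop }
  have hG := (hQ.hasGaussianLaw_obs v a z).map L
  have h1 := HasGaussianLaw.indepFun_of_covariance_eval
    (X := fun (_ : Fin 1) p => p.1 z - w ⬝ᵥ obs a p) (Y := fun i p => obs a p i) hG ?_
  · exact h1.comp (measurable_pi_apply 0) measurable_id
  · intro _ i
    have hsum : (fun p : C(S, ℝ) × (Fin n → ℝ) => p.1 z - w ⬝ᵥ obs a p) =
        (fun p => p.1 z) - fun p => ∑ j, w j * obs a p j := rfl
    rw [hsum, covariance_sub_left (memLp_eval_noisyLaw hQ v _)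
      (memLp_finsetSum _ fun j _ => (memLp_obs hQ v a j).const_mul _) (memLp_obs hQ v a i),
      covariance_eval_obs hQ, covariance_fun_sum_left (fun j => (memLp_obs hQ v a j).const_mul _)
        (memLp_obs hQ v a i)]
    simp only [covariance_const_mul_left, covariance_obs_obs hQ]
    have h2 : ∑ j, w j * M j i = (w ᵥ* M) i := rfl
    have h3 : w ᵥ* M = fun i => k z (a i) := by
      have hs := hpd.isHermitian
      rw [IsHermitian, conjTranspose_eq_transpose_of_trivial] at hs
      rw [← hM] at hs
      rw [← hs, vecMul_transpose, hw, mulVec_mulVec, mul_nonsing_inv _ hdet, one_mulVec]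
    rw [← hM, h2, h3, sub_self]

lemma integral_residual_mul_indicator (hQ : IsGPPrior Q (fun h => h) k) (hv : v ≠ 0)
    (a : Fin n → S) (z : S) {A : Set (Fin n → ℝ)} (hA : MeasurableSet A) :
    ∫ p, (p.1 z - posteriorMean k v (fun i => (a i, obs a p i)) z) *
      A.indicator 1 (obs a p) ∂(noisyLaw Q v n) = 0 := by
  have := hQ.isProbabilityMeasure
  have h1 := (indepFun_residual_obs hQ hv a z).comp measurable_id
    (measurable_one.indicator hA : Measurable (A.indicator (1 : (Fin n → ℝ) → ℝ)))
  have hint (i : Fin n) : Integrable (fun p => obs a p i) (noisyLaw Q v n) :=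
    (memLp_obs hQ v a i).integrable (by norm_num)
  have h0 : ∫ p, (p.1 z - posteriorMean k v (fun i => (a i, obs a p i)) z)
      ∂(noisyLaw Q v n) = 0 := by
    simp_rw [posteriorMean_eq_dotProduct hQ hv, dotProduct]
    rw [integral_sub ((memLp_eval_noisyLaw hQ v _).integrable (by norm_num))
      (integrable_finsetSum _ fun i _ => (hint i).const_mul _), integral_eval_noisyLaw hQ,
      integral_finsetSum _ fun i _ => (hint i).const_mul _]
    simp [integral_const_mul, integral_obs hQ]
  have h2 := h1.integral_fun_mul_eq_mul_integral ?_ ?_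
  · simp only [Function.comp_def, id] at h2
    rw [h2, h0, zero_mul]
  · simp only [Function.comp_def, id, posteriorMean_eq_dotProduct hQ hv, dotProduct]
    exact (memLp_eval_noisyLaw hQ v z).1.sub
      (memLp_finsetSum _ fun i _ => (memLp_obs hQ v a i).const_mul _).1
  · exact ((measurable_one.indicator hA).comp (measurable_obs a)).aestronglyMeasurable

end FixedDesignMoments

/-! ### Bayes' rule at fixed inputs -/

section FixedDesignPosterior

open Matrix

lemma continuous_likelihood_obs {n : ℕ} (v : ℝ≥0) (m : Fin n → ℝ) :
    Continuous (fun y => gaussianLikelihood v m y) :=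
  continuous_gaussianLikelihood v continuous_const continuous_id

section

variable {S : Type*} [TopologicalSpace S] {Q : Measure C(S, ℝ)} {k : S → S → ℝ} {v : ℝ≥0} {n : ℕ}

lemma measurable_likelihood_fun (v : ℝ≥0) (a : Fin n → S) (y : Fin n → ℝ) :
    Measurable (fun h : C(S, ℝ) => gaussianLikelihood v (fun i => h (a i)) y) :=
  measurable_gaussianLikelihood v (measurable_evals a) measurable_const

lemma integrable_likelihood [IsFiniteMeasure Q] (v : ℝ≥0) (a : Fin n → S) (y : Fin n → ℝ) :
    Integrable (fun h : C(S, ℝ) => gaussianLikelihood v (fun i => h (a i)) y) Q :=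
  Integrable.of_bound (measurable_likelihood_fun v a y).aestronglyMeasurable
    ((√(2 * Real.pi * v))⁻¹ ^ Fintype.card (Fin n)) (ae_of_all _ fun h => by
      rw [Real.norm_of_nonneg (gaussianLikelihood_nonneg _ _ _)]
      exact gaussianLikelihood_le _ _ _)

lemma continuous_posteriorMean (hQ : IsGPPrior Q (fun h => h) k) (hv : v ≠ 0) (a : Fin n → S)
    (z : S) : Continuous (fun y : Fin n → ℝ => posteriorMean k v (fun i => (a i, y i)) z) := by
  simp_rw [posteriorMean_eq_dotProduct hQ hv, dotProduct]
  fun_prop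

lemma norm_eval_mul_likelihood_le [CompactSpace S] (v : ℝ≥0) (a : Fin n → S) (y : Fin n → ℝ) (z : S)
    (h : C(S, ℝ)) : ‖h z * gaussianLikelihood v (fun i => h (a i)) y‖ ≤
      ‖h‖ * (√(2 * Real.pi * v))⁻¹ ^ Fintype.card (Fin n) := by
  rw [norm_mul, Real.norm_of_nonneg (gaussianLikelihood_nonneg _ _ _)]
  exact mul_le_mul (h.norm_coe_le_norm z) (gaussianLikelihood_le _ _ _)
    (gaussianLikelihood_nonneg _ _ _) (norm_nonneg _)

end

variable {S : Type*} [MetricSpace S] [CompactSpace S] [Nonempty S] {Q : Measure C(S, ℝ)}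
  {k : S → S → ℝ} {v : ℝ≥0} {n : ℕ}

/-- Bayes' rule for observations at fixed inputs: averaging the values at `z` of all functions,
weighted by their likelihood, gives the posterior mean. The identity holds for almost all
observations because the error of the posterior mean is independent of the observations, and then
for all by continuity. -/
lemma integral_eval_mul_likelihood (hQ : IsGPPrior Q (fun h => h) k) (hv : v ≠ 0) (a : Fin n → S)
    (y : Fin n → ℝ) (z : S) :
    ∫ h, h z * gaussianLikelihood v (fun i => h (a i)) y ∂Q =
      posteriorMean k v (fun i => (a i, y i)) z *
        ∫ h, gaussianLikelihood v (fun i => h (a i)) y ∂Q := by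
  have := hQ.isProbabilityMeasure
  set μ : (Fin n → ℝ) → ℝ := fun y => posteriorMean k v (fun i => (a i, y i)) z with hμ
  have hμc : Continuous μ := continuous_posteriorMean hQ hv a z
  set ℓ : C(S, ℝ) × (Fin n → ℝ) → ℝ :=
    fun p => gaussianLikelihood v (fun i => p.1 (a i)) p.2 with hℓ
  have hℓm : Measurable ℓ := measurable_likelihood_evals v a
  have hℓ0 (p) : 0 ≤ ℓ p := gaussianLikelihood_nonneg _ _ _
  have hmap := map_noisyLaw_obs (Q := Q) hv a
  have hpair : Measurable (fun p : C(S, ℝ) × (Fin n → ℝ) => (p.1, obs a p)) :=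
    measurable_fst.prodMk (measurable_obs a)
  have hr : Measurable (fun q : C(S, ℝ) × (Fin n → ℝ) => q.1 z - μ q.2) :=
    ((measurable_eval z).comp measurable_fst).sub (hμc.measurable.comp measurable_snd)
  -- the density-weighted residual
  set Φ : C(S, ℝ) × (Fin n → ℝ) → ℝ := fun q => ℓ q * (q.1 z - μ q.2) with hΦ
  have hΦint : Integrable Φ (Q.prod volume) := by
    have h1 : Integrable (fun p => p.1 z - μ (obs a p)) (noisyLaw Q v n) := by
      refine ((memLp_eval_noisyLaw hQ v z).integrable (by norm_num)).sub ?_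
      simp only [hμ, posteriorMean_eq_dotProduct hQ hv, dotProduct]
      exact integrable_finsetSum _ fun i _ =>
        ((memLp_obs hQ v a i).integrable (by norm_num)).const_mul _
    have h2 : Integrable (fun q : C(S, ℝ) × (Fin n → ℝ) => q.1 z - μ q.2)
        ((noisyLaw Q v n).map (fun p => (p.1, obs a p))) :=
      (integrable_map_measure hr.aestronglyMeasurable hpair.aemeasurable).2 h1
    rw [hmap, integrable_withDensity_iff_integrable_smul' hℓm.ennreal_ofReal
      (ae_of_all _ fun _ => ENNReal.ofReal_lt_top)] at h2
    simpa only [ENNReal.toReal_ofReal (hℓ0 _), smul_eq_mul] using h2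
  have hzero {A : Set (Fin n → ℝ)} (hA : MeasurableSet A) :
      ∫ y in A, ∫ h, Φ (h, y) ∂Q = 0 := by
    have h1 := integral_residual_mul_indicator hQ hv a z hA
    have h2 : ∫ q, (q.1 z - μ q.2) * A.indicator 1 q.2
        ∂((noisyLaw Q v n).map (fun p => (p.1, obs a p))) = 0 := by
      rw [integral_map hpair.aemeasurable]
      · exact h1
      · exact (hr.mul ((measurable_one.indicator hA).comp measurable_snd)).aestronglyMeasurable
    rw [hmap, integral_withDensity_eq_integral_toReal_smul hℓm.ennreal_ofReal
      (ae_of_all _ fun _ => ENNReal.ofReal_lt_top)] at h2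
    have h3 (q : C(S, ℝ) × (Fin n → ℝ)) : (ENNReal.ofReal (ℓ q)).toReal •
        ((q.1 z - μ q.2) * A.indicator 1 q.2) = (Set.univ ×ˢ A).indicator Φ q := by
      rw [ENNReal.toReal_ofReal (hℓ0 _)]
      by_cases hq : q.2 ∈ A <;> simp [Set.indicator, hq, hΦ]
    replace h2 := (integral_congr_ae (ae_of_all _ fun q => (h3 q).symm)).trans h2
    rw [integral_indicator (MeasurableSet.univ.prod hA), ← Measure.prod_restrict,
      Measure.restrict_univ, integral_prod_symm] at h2
    · exact h2
    · rw [← Measure.restrict_univ (μ := Q), Measure.prod_restrict]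
      exact hΦint.restrict
  have hae : (fun y => ∫ h, Φ (h, y) ∂Q) =ᵐ[volume] 0 :=
    hΦint.integral_prod_right.ae_eq_zero_of_forall_setIntegral_eq_zero
      fun A hA _ => hzero hA
  have hint1 (y : Fin n → ℝ) :
      Integrable (fun h : C(S, ℝ) => h z * gaussianLikelihood v (fun i => h (a i)) y) Q :=
    Integrable.mono' (hQ.integrable_norm.mul_const _)
      ((measurable_eval z).mul (measurable_likelihood_fun v a y)).aestronglyMeasurable
      (ae_of_all _ fun h => norm_eval_mul_likelihood_le v a y z h)
  have hG (y : Fin n → ℝ) : ∫ h, Φ (h, y) ∂Q =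
      (∫ h, h z * gaussianLikelihood v (fun i => h (a i)) y ∂Q) -
        μ y * ∫ h, gaussianLikelihood v (fun i => h (a i)) y ∂Q := by
    rw [← integral_const_mul, ← integral_sub (hint1 y) ((integrable_likelihood v a y).const_mul _)]
    refine integral_congr_ae (ae_of_all _ fun h => ?_)
    simp only [hΦ, hℓ]
    ring
  have hcont : Continuous (fun y => ∫ h, Φ (h, y) ∂Q) := by
    simp_rw [hG]
    refine Continuous.sub ?_ (hμc.mul ?_)
    · exact continuous_of_dominated
        (fun y => ((measurable_eval z).mul (measurable_likelihood_fun v a y)).aestronglyMeasurable)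
        (fun y => ae_of_all _ fun h => norm_eval_mul_likelihood_le v a y z h)
        (hQ.integrable_norm.mul_const _)
        (ae_of_all _ fun h => continuous_const.mul (continuous_likelihood_obs v _))
    · refine continuous_of_dominated
        (fun y => (measurable_likelihood_fun v a y).aestronglyMeasurable)
        (bound := fun _ => (√(2 * Real.pi * v))⁻¹ ^ Fintype.card (Fin n))
        (fun y => ae_of_all _ fun h => ?_) (integrable_const _)
        (ae_of_all _ fun h => continuous_likelihood_obs v _)
      rw [Real.norm_of_nonneg (gaussianLikelihood_nonneg _ _ _)]
      exact gaussianLikelihood_le _ _ _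
  have h0 := congrFun (Measure.eq_of_ae_eq hae hcont continuous_const) y
  rw [hG] at h0
  exact sub_eq_zero.1 h0

end FixedDesignPosterior

/-! ### Entropy and mutual information of Gaussian vectors -/

section Entropy

open Matrix

lemma log_gaussianPDFReal {v : ℝ≥0} (hv : v ≠ 0) (m y : ℝ) :
    Real.log (gaussianPDFReal m v y) =
      -(Real.log (2 * Real.pi * v) / 2) - (y - m) ^ 2 / (2 * v) := by
  have hv' : 0 < (v : ℝ) := by positivity
  rw [gaussianPDFReal, Real.log_mul (by positivity) (by positivity), Real.log_exp, Real.log_inv,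
    Real.log_sqrt (by positivity)]
  ring

variable {ι : Type*} [Fintype ι]

lemma log_gaussianLikelihood {v : ℝ≥0} (hv : v ≠ 0) (m y : ι → ℝ) :
    Real.log (gaussianLikelihood v m y) =
      ∑ i, (-(Real.log (2 * Real.pi * v) / 2) - (y i - m i) ^ 2 / (2 * v)) := by
  rw [gaussianLikelihood, Real.log_prod fun i _ => (gaussianPDFReal_pos _ _ _ hv).ne']
  simp_rw [log_gaussianPDFReal hv]

lemma integrable_sq_gaussianReal (v : ℝ≥0) : Integrable (fun x => x ^ 2) (gaussianReal 0 v) :=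
  (memLp_id_gaussianReal' 2 (by norm_num)).integrable_sq

lemma integral_sq_gaussianReal (v : ℝ≥0) : ∫ x, x ^ 2 ∂(gaussianReal 0 v) = v := by
  have h := variance_id_gaussianReal (μ := 0) (v := v)
  rwa [variance_of_integral_eq_zero aemeasurable_id (by simp)] at h

/-- The negative entropy of a vector of independent centred Gaussian variables. -/
lemma integral_log_gaussianLikelihood {Ω : Type*} [MeasurableSpace Ω] {P : Measure Ω} {v : ℝ≥0}
    (hv : v ≠ 0) {W : Ω → ι → ℝ} (hW : Measurable W)
    (hmap : P.map W = Measure.pi fun _ => gaussianReal 0 v) :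
    Integrable (fun ω => Real.log (gaussianLikelihood v 0 (W ω))) P ∧
      ∫ ω, Real.log (gaussianLikelihood v 0 (W ω)) ∂P =
        -(Fintype.card ι * ((Real.log (2 * Real.pi * v) + 1) / 2)) := by
  have hWi (i : ι) : Measurable (fun ω => W ω i) := (measurable_pi_apply i).comp hW
  have hmapi (i : ι) : P.map (fun ω => W ω i) = gaussianReal 0 v := by
    rw [← (measurePreserving_eval (fun _ : ι => gaussianReal 0 v) i).map_eq, ← hmap,
      Measure.map_map (measurable_pi_apply i) hW]
    rfl
  have hP : IsProbabilityMeasure P := by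
    rw [← Measure.isProbabilityMeasure_map_iff hW.aemeasurable, hmap]
    infer_instance
  have hsq (i : ι) : Integrable (fun ω => W ω i ^ 2) P := by
    have h := integrable_sq_gaussianReal v
    rw [← hmapi i] at h
    exact h.comp_measurable (hWi i)
  have hsq' (i : ι) : ∫ ω, W ω i ^ 2 ∂P = v := by
    have h := integral_sq_gaussianReal v
    rwa [← hmapi i, integral_map (hWi i).aemeasurable (by fun_prop)] at h
  have hint (i : ι) : Integrable
      (fun ω => -(Real.log (2 * Real.pi * v) / 2) - (W ω i) ^ 2 / (2 * v)) P :=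
    (integrable_const _).sub ((hsq i).div_const _)
  simp only [log_gaussianLikelihood hv, Pi.zero_apply, sub_zero]
  refine ⟨integrable_finsetSum _ fun i _ => hint i, ?_⟩
  rw [integral_finsetSum _ fun i _ => hint i]
  have h1 (i : ι) : ∫ ω, (-(Real.log (2 * Real.pi * v) / 2) - (W ω i) ^ 2 / (2 * v)) ∂P =
      -((Real.log (2 * Real.pi * v) + 1) / 2) := by
    rw [integral_sub (integrable_const _) ((hsq i).div_const _), integral_div, hsq',
      integral_const, probReal_univ, one_smul]
    have : (v : ℝ) ≠ 0 := by positivity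
    field_simp
    ring
  simp [h1]

/-- If `μ` has a positive density with respect to `ν`, the log-likelihood ratio is the logarithm of
the density. -/
lemma llr_withDensity_ae_eq {α : Type*} [MeasurableSpace α] (ν : Measure α) [SigmaFinite ν]
    {g : α → ℝ} (hg : Measurable g) (hpos : ∀ x, 0 < g x) :
    llr (ν.withDensity fun x => ENNReal.ofReal (g x)) ν =ᵐ[ν.withDensity fun x =>
      ENNReal.ofReal (g x)] fun x => Real.log (g x) := by
  refine (withDensity_absolutelyContinuous ν _).ae_le ?_
  filter_upwards [Measure.rnDeriv_withDensity ν hg.ennreal_ofReal] with x hx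
  rw [llr, hx, ENNReal.toReal_ofReal (hpos x).le]

/-- A positive definite matrix can be whitened. -/
lemma exists_whitening [DecidableEq ι] {M : Matrix ι ι ℝ} (hM : M.PosDef) :
    ∃ A : Matrix ι ι ℝ, A * M * Aᵀ = 1 ∧ A.det ≠ 0 ∧
      Real.log |A.det| = -(Real.log M.det / 2) := by
  open scoped MatrixOrder in
  obtain ⟨B, hB⟩ := CStarAlgebra.nonneg_iff_eq_star_mul_self.mp hM.posSemidef.nonneg
  rw [star_eq_conjTranspose, conjTranspose_eq_transpose_of_trivial] at hB
  have hdet : M.det = B.det * B.det := by rw [hB, det_mul, det_transpose]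
  have hpos := hM.det_pos
  have hB0 : B.det ≠ 0 := fun h => by rw [hdet, h] at hpos; simp at hpos
  have hBu : IsUnit B.det := hB0.isUnit
  have hBtu : IsUnit Bᵀ.det := by rwa [det_transpose]
  refine ⟨(Bᵀ)⁻¹, ?_, ?_, ?_⟩
  · rw [hB, ← Matrix.mul_assoc, nonsing_inv_mul _ hBtu, Matrix.one_mul, transpose_nonsing_inv,
      transpose_transpose, mul_nonsing_inv _ hBu]
  · rw [det_nonsing_inv, det_transpose, Ring.inverse_eq_inv']
    exact inv_ne_zero hB0
  · rw [det_nonsing_inv, det_transpose, Ring.inverse_eq_inv', abs_inv, Real.log_inv, hdet,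
      Real.log_mul hB0 hB0, Real.log_abs]
    ring

end Entropy

section MutualInformation

open Matrix

variable {S : Type*} [TopologicalSpace S] {Q : Measure C(S, ℝ)} {k : S → S → ℝ} {v : ℝ≥0} {n : ℕ}

/-- The joint law of the noisy observations and of the values of the function. -/
lemma map_obs_evals_eq_withDensity [SFinite Q] (hv : v ≠ 0) (a : Fin n → S) :
    (noisyLaw Q v n).map (fun p => (obs a p, fun i => p.1 (a i))) =
      ((volume : Measure (Fin n → ℝ)).prod (Q.map fun h i => h (a i))).withDensity fun q =>
        ENNReal.ofReal (gaussianLikelihood v q.2 q.1) := by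
  have hℓ : Measurable (fun q : (Fin n → ℝ) × (Fin n → ℝ) => gaussianLikelihood v q.2 q.1) :=
    measurable_gaussianLikelihood v measurable_snd measurable_fst
  have he : Measurable (fun p : C(S, ℝ) × (Fin n → ℝ) => fun i => p.1 (a i)) :=
    (measurable_evals a).comp measurable_fst
  have hpair := (measurable_obs a).prodMk he
  refine Measure.ext_of_lintegral _ fun F hF => ?_
  rw [lintegral_map hF hpair, lintegral_withDensity_eq_lintegral_mul _ hℓ.ennreal_ofReal hF,
    lintegral_prod_symm _ (hℓ.ennreal_ofReal.mul hF).aemeasurable,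
    lintegral_map (by
      exact (hℓ.ennreal_ofReal.mul hF).lintegral_prod_left') (measurable_evals a),
    lintegral_prod _ (by exact (hF.comp hpair).aemeasurable)]
  refine lintegral_congr fun h => ?_
  exact lintegral_gaussian_noise hv (fun i => h (a i)) (F := fun y => F (y, fun i => h (a i)))
    (hF.comp (by fun_prop))

/-- The information gain of a sequence of observations is the sum of the information gains of the
single observations, which depend on the successive posterior variances. -/
lemma IsGPPrior.log_det_eq_sum (hQ : IsGPPrior Q (fun h => h) k) (hv : v ≠ 0)
    (x : ℕ → S × ℝ) (n : ℕ) :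
    Real.log (regKernelMatrix k v (fun i : Fin n => (x i).1)).det - n * Real.log v =
      ∑ t ∈ Finset.range n,
        Real.log (1 + (v : ℝ)⁻¹ * posteriorVar k v (fun i : Fin t => x i) (x t).1) := by
  have hv' : 0 < (v : ℝ) := by positivity
  induction n with
  | zero => simp
  | succ n ih =>
    rw [Finset.sum_range_succ, ← ih, hQ.det_succ hv' (fun i : Fin (n + 1) => x i)]
    have h1 := hQ.posteriorVar_nonneg hv' (fun i : Fin n => x i) (x n).1
    have h2 := (hQ.posDef hv' (fun i : Fin n => (x i).1)).det_pos
    have h3 : 1 + (v : ℝ)⁻¹ * posteriorVar k v (fun i : Fin n => x i) (x n).1 =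
        (v + posteriorVar k v (fun i : Fin n => x i) (x n).1) / v := by field_simp
    rw [h3, Real.log_div (by positivity) hv'.ne']
    simp only [Fin.val_castSucc, Fin.val_last]
    rw [Real.log_mul h2.ne' (by positivity)]
    push_cast
    ring

variable [Nonempty S]

lemma map_whitened_obs (hQ : IsGPPrior Q (fun h => h) k) (a : Fin n → S)
    {A : Matrix (Fin n) (Fin n) ℝ} (hA : A * regKernelMatrix k v a * Aᵀ = 1) :
    (noisyLaw Q v n).map (fun p => A *ᵥ obs a p) = Measure.pi fun _ => gaussianReal 0 1 := by
  have := hQ.isProbabilityMeasure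
  let L : (Fin n → ℝ) →L[ℝ] (Fin n → ℝ) := (Matrix.mulVecLin A).toContinuousLinearMap
  have hG : HasGaussianLaw (fun p => A *ᵥ obs a p) (noisyLaw Q v n) :=
    (hQ.hasGaussianLaw_obs v a (Classical.arbitrary S)).snd.map L
  have hi (i : Fin n) : (fun p => (A *ᵥ obs a p) i) = fun p => ∑ j, A i j * obs a p j := rfl
  have hmem (i j : Fin n) : MemLp (fun p => A i j * obs a p j) 2 (noisyLaw Q v n) :=
    (memLp_obs hQ v a j).const_mul _
  have hcov (i j : Fin n) : cov[fun p => (A *ᵥ obs a p) i, fun p => (A *ᵥ obs a p) j;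
      noisyLaw Q v n] = if i = j then 1 else 0 := by
    rw [hi, hi, covariance_fun_sum_fun_sum (hmem i) (hmem j)]
    simp only [covariance_const_mul_left, covariance_const_mul_right, covariance_obs_obs hQ]
    rw [← Matrix.one_apply, ← hA, Matrix.mul_apply]
    simp only [Matrix.mul_apply, transpose_apply, Finset.sum_mul]
    rw [Finset.sum_comm]
    exact Finset.sum_congr rfl fun _ _ => Finset.sum_congr rfl fun _ _ => by ring
  have hind := HasGaussianLaw.iIndepFun_of_covariance_eq_zero
    (X := fun i p => (A *ᵥ obs a p) i) hG fun i j hij => by rw [hcov, if_neg hij]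
  have h1 := hind.map_fun_eq_pi_map fun i => (hG.eval i).aemeasurable
  refine h1.trans ?_
  congr 1
  ext1 i
  rw [(hG.eval i).map_eq_gaussianReal, ← covariance_self (hG.eval i).aemeasurable, hcov, if_pos rfl,
    hi, integral_finsetSum _ fun j _ => (hmem i j).integrable (by norm_num)]
  simp [integral_const_mul, integral_obs hQ]

/-- The density of the noisy observations, in terms of a whitening matrix `A`. -/
lemma map_obs_eq_withDensity (hQ : IsGPPrior Q (fun h => h) k) (a : Fin n → S)
    {A : Matrix (Fin n) (Fin n) ℝ} (hA : A * regKernelMatrix k v a * Aᵀ = 1) (hdet : A.det ≠ 0) :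
    (noisyLaw Q v n).map (obs a) = volume.withDensity fun y =>
      ENNReal.ofReal (|A.det| * gaussianLikelihood 1 0 (A *ᵥ y)) := by
  have hAm : Measurable (fun y : Fin n → ℝ => A *ᵥ y) :=
    (Matrix.mulVecLin A).toContinuousLinearMap.continuous.measurable
  have hAim : Measurable (fun y : Fin n → ℝ => A⁻¹ *ᵥ y) :=
    (Matrix.mulVecLin A⁻¹).toContinuousLinearMap.continuous.measurable
  have hinv (y : Fin n → ℝ) : A⁻¹ *ᵥ (A *ᵥ y) = y := by
    rw [mulVec_mulVec, nonsing_inv_mul _ hdet.isUnit, one_mulVec]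
  have hℓ : Measurable (fun u : Fin n → ℝ => gaussianLikelihood 1 0 u) :=
    measurable_gaussianLikelihood 1 measurable_const measurable_id
  have hℓA : Measurable (fun y : Fin n → ℝ => gaussianLikelihood 1 0 (A *ᵥ y)) :=
    measurable_gaussianLikelihood 1 measurable_const hAm
  refine Measure.ext_of_lintegral _ fun F hF => ?_
  have hWm : Measurable (fun p => A *ᵥ obs a p) := hAm.comp (measurable_obs a)
  have hG : Measurable (fun u : Fin n → ℝ => F (A⁻¹ *ᵥ u)) := hF.comp hAim
  rw [lintegral_map hF (measurable_obs a), lintegral_withDensity_eq_lintegral_mul _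
    (hℓA.const_mul _).ennreal_ofReal hF]
  calc ∫⁻ p, F (obs a p) ∂(noisyLaw Q v n)
      = ∫⁻ p, F (A⁻¹ *ᵥ (A *ᵥ obs a p)) ∂(noisyLaw Q v n) := by simp_rw [hinv]
    _ = ∫⁻ u, F (A⁻¹ *ᵥ u) ∂(Measure.pi fun _ : Fin n => gaussianReal 0 1) := by
        rw [← map_whitened_obs hQ a hA, lintegral_map hG hWm]
    _ = ∫⁻ u, ENNReal.ofReal (gaussianLikelihood 1 0 u) * F (A⁻¹ *ᵥ u) := by
        have h := pi_gaussianReal_eq_withDensity (one_ne_zero : (1 : ℝ≥0) ≠ 0) (0 : Fin n → ℝ)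
        simp only [Pi.zero_apply] at h
        rw [h, lintegral_withDensity_eq_lintegral_mul _ hℓ.ennreal_ofReal hG]
        rfl
    _ = ENNReal.ofReal |A.det| * ∫⁻ y, ENNReal.ofReal (gaussianLikelihood 1 0 (A *ᵥ y)) *
          F (A⁻¹ *ᵥ (A *ᵥ y)) := by
        have h := Real.map_matrix_volume_pi_eq_smul_volume_pi hdet
        have h2 := congrArg (fun μ : Measure (Fin n → ℝ) =>
          ∫⁻ u, ENNReal.ofReal (gaussianLikelihood 1 0 u) * F (A⁻¹ *ᵥ u) ∂μ) h
        have hlin : (⇑(toLin' A) : (Fin n → ℝ) → (Fin n → ℝ)) = fun y => A *ᵥ y := rfl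
        simp only [hlin, lintegral_smul_measure, smul_eq_mul] at h2
        rw [lintegral_map (f := fun u => ENNReal.ofReal (gaussianLikelihood 1 0 u) * F (A⁻¹ *ᵥ u))
          (hℓ.ennreal_ofReal.mul hG) hAm] at h2
        rw [h2, ← mul_assoc, ← ENNReal.ofReal_mul (abs_nonneg _), ← abs_mul, mul_inv_cancel₀ hdet]
        simp
    _ = _ := by
        rw [← lintegral_const_mul]
        · refine lintegral_congr fun y => ?_
          rw [hinv, Pi.mul_apply, ENNReal.ofReal_mul (abs_nonneg _), mul_assoc]
        · exact hℓA.ennreal_ofReal.mul (by simpa only [hinv] using hF)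

/-- The mutual information between the values of a Gaussian process and their noisy observations is
half the logarithm of `det (K + v I) / det (v I)`. The joint law has a density with respect to the
product of the marginal laws, the quotient of the likelihood and of the marginal density of the
observations; both are Gaussian densities evaluated at whitened vectors, so that the quadratic terms
of the logarithm cancel on average. -/
lemma mutualInformation_obs (hQ : IsGPPrior Q (fun h => h) k) (hv : v ≠ 0) (a : Fin n → S) :
    mutualInformation (noisyLaw Q v n) (fun p i => p.1 (a i) + p.2 i) (fun p i => p.1 (a i)) =
      ENNReal.ofReal ((Real.log (regKernelMatrix k v a).det - n * Real.log v) / 2) := by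
  have := hQ.isProbabilityMeasure
  have hv' : 0 < (v : ℝ) := by positivity
  obtain ⟨A, hA, hdet, hlog⟩ := exists_whitening (hQ.posDef hv' a)
  have hdet' : 0 < |A.det| := abs_pos.2 hdet
  have hAm : Measurable (fun y : Fin n → ℝ => A *ᵥ y) :=
    (Matrix.mulVecLin A).toContinuousLinearMap.continuous.measurable
  set ℓ : (Fin n → ℝ) × (Fin n → ℝ) → ℝ := fun q => gaussianLikelihood v q.2 q.1 with hℓ
  have hℓm : Measurable ℓ := measurable_gaussianLikelihood v measurable_snd measurable_fst
  have hℓ0 (q) : 0 < ℓ q := gaussianLikelihood_pos hv _ _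
  set m : (Fin n → ℝ) → ℝ := fun y => |A.det| * gaussianLikelihood 1 0 (A *ᵥ y) with hm
  have hmm : Measurable m := (measurable_gaussianLikelihood 1 measurable_const hAm).const_mul _
  have hm0 (y) : 0 < m y := mul_pos hdet' (gaussianLikelihood_pos one_ne_zero _ _)
  have he : Measurable (fun p : C(S, ℝ) × (Fin n → ℝ) => fun i => p.1 (a i)) :=
    (measurable_evals a).comp measurable_fst
  have hpair : Measurable (fun p : C(S, ℝ) × (Fin n → ℝ) => (obs a p, fun i => p.1 (a i))) :=
    (measurable_obs a).prodMk he
  set J := (noisyLaw Q v n).map (fun p => (obs a p, fun i => p.1 (a i))) with hJ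
  set R := ((noisyLaw Q v n).map (obs a)).prod ((noisyLaw Q v n).map fun p i => p.1 (a i)) with hR
  have : IsProbabilityMeasure ((noisyLaw Q v n).map (obs a)) :=
    Measure.isProbabilityMeasure_map (measurable_obs a).aemeasurable
  have : IsProbabilityMeasure ((noisyLaw Q v n).map fun p i => p.1 (a i)) :=
    Measure.isProbabilityMeasure_map he.aemeasurable
  have hJprob : IsProbabilityMeasure J := Measure.isProbabilityMeasure_map hpair.aemeasurable
  set g : (Fin n → ℝ) × (Fin n → ℝ) → ℝ := fun q => ℓ q / m q.1 with hg
  have hgm : Measurable g := hℓm.div (hmm.comp measurable_fst)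
  have hg0 (q) : 0 < g q := div_pos (hℓ0 q) (hm0 q.1)
  have hmm1 : Measurable (fun q : (Fin n → ℝ) × (Fin n → ℝ) => ENNReal.ofReal (m q.1)) :=
    (hmm.comp measurable_fst).ennreal_ofReal
  have hJR : J = R.withDensity fun q => ENNReal.ofReal (g q) := by
    have h1 : (noisyLaw Q v n).map (fun p i => p.1 (a i)) = Q.map fun h i => h (a i) := by
      have h2 : (noisyLaw Q v n).map Prod.fst = Q := by simp [noisyLaw, Measure.map_fst_prod]
      conv_rhs => rw [← h2]
      rw [Measure.map_map (measurable_evals a) measurable_fst]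
      rfl
    rw [hJ, hR, map_obs_evals_eq_withDensity hv, map_obs_eq_withDensity hQ a hA hdet, h1,
      prod_withDensity_left hmm.ennreal_ofReal, ← withDensity_mul _ hmm1
        hgm.ennreal_ofReal]
    congr 1
    ext q
    rw [Pi.mul_apply, ← ENNReal.ofReal_mul (hm0 _).le, mul_div_cancel₀ _ (hm0 _).ne']
  have hllr : llr J R =ᵐ[J] fun q => Real.log (g q) := by
    rw [hJR]
    exact llr_withDensity_ae_eq R hgm hg0
  -- the logarithm of the density, as a function of the noise and of the whitened observations
  have hlogg (p : C(S, ℝ) × (Fin n → ℝ)) : Real.log (g (obs a p, fun i => p.1 (a i))) =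
      Real.log (gaussianLikelihood v 0 p.2) - (Real.log |A.det| +
        Real.log (gaussianLikelihood 1 0 (A *ᵥ obs a p))) := by
    rw [Real.log_div (hℓ0 _).ne' (hm0 _).ne', hm, Real.log_mul hdet'.ne'
      (gaussianLikelihood_pos one_ne_zero _ _).ne']
    congr 1
    simp [hℓ, log_gaussianLikelihood hv, obs]
  obtain ⟨hi1, he1⟩ := integral_log_gaussianLikelihood (P := noisyLaw Q v n) hv measurable_snd
    (by simp [noisyLaw, Measure.map_snd_prod])
  obtain ⟨hi2, he2⟩ := integral_log_gaussianLikelihood (P := noisyLaw Q v n) one_ne_zero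
    (hAm.comp (measurable_obs a)) (map_whitened_obs hQ a hA)
  have hlgm : Measurable (fun q => Real.log (g q)) := Real.measurable_log.comp hgm
  have hi3 := (integrable_const (μ := noisyLaw Q v n) (Real.log |A.det|)).add hi2
  have hint : Integrable (fun q => Real.log (g q)) J := by
    rw [hJ, integrable_map_measure hlgm.aestronglyMeasurable hpair.aemeasurable]
    simp only [Function.comp_def, hlogg]
    exact hi1.sub hi3
  rw [mutualInformation]
  change InformationTheory.klDiv J R = _
  rw [InformationTheory.klDiv_of_ac_of_integrable
    (hJR ▸ withDensity_absolutelyContinuous R _) ((integrable_congr hllr).2 hint),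
    integral_congr_ae hllr, probReal_univ, probReal_univ, hJ,
    integral_map hpair.aemeasurable hlgm.aestronglyMeasurable]
  congr 1
  simp only [hlogg]
  have h4 : ∫ p, (Real.log (gaussianLikelihood v 0 p.2) - (Real.log |A.det| +
      Real.log (gaussianLikelihood 1 0 (A *ᵥ obs a p)))) ∂(noisyLaw Q v n) =
      -(n * ((Real.log (2 * Real.pi * v) + 1) / 2)) - (Real.log |A.det| +
        -(n * ((Real.log (2 * Real.pi) + 1) / 2))) := by
    refine (integral_sub hi1 hi3).trans ?_
    rw [he1]
    congr 1
    · simp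
    · refine (integral_add (integrable_const _) hi2).trans ?_
      rw [integral_const, probReal_univ, one_smul]
      congr 1
      simpa using he2
  rw [h4, hlog, Real.log_mul (by positivity) hv'.ne']
  ring

/-- The sum of the successive posterior variances at any sequence of inputs is at most
`2 / log (1 + v⁻¹)` times the maximum information gain: `s ≤ log (1 + s / v) / log (1 + 1 / v)` for
`s ∈ [0, 1]`, by concavity of the logarithm. -/
lemma IsGPPrior.sum_posteriorVar_le (hQ : IsGPPrior Q (fun h => h) k) (hk : ∀ z, k z z ≤ 1)
    (hv : v ≠ 0) (x : ℕ → S × ℝ) (n : ℕ) :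
    ENNReal.ofReal (∑ t ∈ Finset.range n, posteriorVar k v (fun i : Fin t => x i) (x t).1) ≤
      ENNReal.ofReal (2 / Real.log (1 + (v : ℝ)⁻¹)) * maxInformationGain Q v n := by
  have hv' : 0 < (v : ℝ) := by positivity
  have hc : 0 < Real.log (1 + (v : ℝ)⁻¹) := Real.log_pos (by
    have : 0 < (v : ℝ)⁻¹ := by positivity
    linarith)
  have hI : ENNReal.ofReal ((∑ t ∈ Finset.range n,
      Real.log (1 + (v : ℝ)⁻¹ * posteriorVar k v (fun i : Fin t => x i) (x t).1)) / 2) ≤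
      maxInformationGain Q v n := by
    rw [← hQ.log_det_eq_sum hv, ← mutualInformation_obs hQ hv]
    exact le_iSup (fun a : Fin n → S => mutualInformation (noisyLaw Q v n)
      (fun p i => p.1 (a i) + p.2 i) (fun p i => p.1 (a i))) (fun i => (x i).1)
  refine le_trans ?_ (mul_le_mul_right hI _)
  rw [← ENNReal.ofReal_mul (by positivity)]
  refine ENNReal.ofReal_le_ofReal ?_
  rw [div_mul_div_comm, mul_comm 2, mul_div_mul_right _ _ two_ne_zero, le_div_iff₀ hc,
    Finset.sum_mul]
  refine Finset.sum_le_sum fun t _ => ?_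
  have h0 := hQ.posteriorVar_nonneg hv' (fun i : Fin t => x i) (x t).1
  have h1 := (hQ.posteriorVar_le hv' (fun i : Fin t => x i) (x t).1).trans (hk _)
  have hvi : 0 < (v : ℝ)⁻¹ := by positivity
  rw [← Real.log_rpow (by positivity)]
  refine Real.log_le_log (by positivity) ?_
  rw [mul_comm (v : ℝ)⁻¹]
  exact rpow_one_add_le_one_add_mul_self (by linarith) h0 h1

end MutualInformation

/-! ### The posterior after adaptively chosen queries -/

section Data

lemma measurable_snoc {S : Type*} [MeasurableSpace S] {n : ℕ} :
    Measurable (fun p : (Fin n → S × ℝ) × S × ℝ =>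
      (Fin.snoc (α := fun _ => S × ℝ) p.1 p.2 : Fin (n + 1) → S × ℝ)) := by
  refine measurable_pi_lambda _ fun i => ?_
  refine Fin.lastCases ?_ (fun i => ?_) i
  · simpa using measurable_snd
  · simp only [Fin.snoc_castSucc]
    fun_prop

variable {S : Type*} [TopologicalSpace S] {n : ℕ}

/-- The likelihood of the data `d` for the function `h`. -/
noncomputable def dataLikelihood (v : ℝ≥0) (d : Fin n → S × ℝ) (h : C(S, ℝ)) : ℝ :=
  gaussianLikelihood v (fun i => h (d i).1) (fun i => (d i).2)

lemma dataLikelihood_nonneg (v : ℝ≥0) (d : Fin n → S × ℝ) (h : C(S, ℝ)) :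
    0 ≤ dataLikelihood v d h := gaussianLikelihood_nonneg _ _ _

lemma dataLikelihood_snoc (v : ℝ≥0) (d : Fin n → S × ℝ) (s : S) (y : ℝ) (h : C(S, ℝ)) :
    dataLikelihood v (Fin.snoc (α := fun _ => S × ℝ) d (s, y)) h =
      dataLikelihood v d h * gaussianPDFReal (h s) v y := by
  simp [dataLikelihood, gaussianLikelihood, Fin.prod_univ_castSucc]

lemma data_succ {Ω : Type*} (f : Ω → C(S, ℝ)) (x : ℕ → Ω → S) (ε : ℕ → Ω → ℝ) (n : ℕ) (ω : Ω) :
    data f x ε (n + 1) ω = Fin.snoc (α := fun _ => S × ℝ) (data f x ε n ω)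
      (x n ω, f ω (x n ω) + ε n ω) := by
  ext1 i
  refine Fin.lastCases ?_ (fun i => ?_) i <;> simp [data]

end Data

section Run

variable {Ω S : Type*} [MeasurableSpace Ω] [MetricSpace S] [CompactSpace S]
  [MeasurableSpace S] [BorelSpace S] {P : Measure Ω} [IsProbabilityMeasure P]
  {f : Ω → C(S, ℝ)} {v : ℝ≥0} {x : ℕ → Ω → S} {ε : ℕ → Ω → ℝ} {g : ℕ → Ω → C(S, ℝ)} {n : ℕ}

lemma measurable_eval_pair : Measurable (fun p : C(S, ℝ) × S => p.1 p.2) :=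
  (by fun_prop : Continuous (fun p : C(S, ℝ) × S => p.1 p.2)).measurable

lemma measurable_dataLikelihood (v : ℝ≥0) : Measurable
    (fun p : (Fin n → S × ℝ) × C(S, ℝ) => dataLikelihood v p.1 p.2) := by
  refine measurable_gaussianLikelihood v (measurable_pi_lambda _ fun i => ?_)
    (measurable_pi_lambda _ fun i => ?_)
  · have h : Measurable (fun p : (Fin n → S × ℝ) × C(S, ℝ) => (p.2, (p.1 i).1)) := by fun_prop
    exact measurable_eval_pair.comp h
  · fun_prop

lemma IsRun.measurable_data (hrun : IsRun P f v x ε g) (hf : Measurable f) (n : ℕ) :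
    Measurable (data f x ε n) := by
  refine measurable_pi_lambda _ fun i => (hrun.measurable_x i).prodMk (Measurable.add ?_
    (hrun.measurable_ε i))
  exact measurable_eval_pair.comp (hf.prodMk (hrun.measurable_x i))

/-- The noise of the current round is independent of the past, and turns into a likelihood. -/
lemma IsRun.lintegral_noise (hrun : IsRun P f v x ε g) (hf : Measurable f) (hv : v ≠ 0)
    {F : (Fin (n + 1) → S × ℝ) × C(S, ℝ) → ℝ≥0∞} (hF : Measurable F) :
    ∫⁻ ω, F (data f x ε (n + 1) ω, f ω) ∂P =
      ∫⁻ ω, ∫⁻ y, ENNReal.ofReal (gaussianPDFReal (f ω (x n ω)) v y) *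
        F (Fin.snoc (α := fun _ => S × ℝ) (data f x ε n ω) (x n ω, y), f ω) ∂volume ∂P := by
  have hD := hrun.measurable_data hf n
  have hx := hrun.measurable_x n
  have hε := hrun.measurable_ε n
  set D := data f x ε n with hDdef
  have hpast : Measurable (fun ω => (f ω, D ω, g n ω, x n ω)) :=
    hf.prodMk (hD.prodMk ((hrun.measurable_g n).prodMk hx))
  have hprod := (indepFun_iff_map_prod_eq_prod_map_map hε.aemeasurable
    hpast.aemeasurable).1 (hrun.noise_indep n)
  rw [(hrun.noise_law n).map_eq] at hprod
  let H : ℝ × (C(S, ℝ) × (Fin n → S × ℝ) × C(S, ℝ) × S) → ℝ≥0∞ := fun q =>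
    F (Fin.snoc (α := fun _ => S × ℝ) q.2.2.1 (q.2.2.2.2, q.2.1 q.2.2.2.2 + q.1), q.2.1)
  have hH : Measurable H := by
    have he : Measurable (fun q : ℝ × (C(S, ℝ) × (Fin n → S × ℝ) × C(S, ℝ) × S) =>
        q.2.1 q.2.2.2.2) := measurable_eval_pair.comp
      (by fun_prop : Measurable fun q : ℝ × (C(S, ℝ) × (Fin n → S × ℝ) × C(S, ℝ) × S) =>
        (q.2.1, q.2.2.2.2))
    refine hF.comp (Measurable.prodMk ?_ (by fun_prop))
    exact measurable_snoc.comp (Measurable.prodMk (by fun_prop)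
      (Measurable.prodMk (by fun_prop) (he.add (by fun_prop))))
  calc ∫⁻ ω, F (data f x ε (n + 1) ω, f ω) ∂P
      = ∫⁻ ω, H (ε n ω, (f ω, D ω, g n ω, x n ω)) ∂P := by simp_rw [data_succ]; rfl
    _ = ∫⁻ ω, ∫⁻ e, H (e, (f ω, D ω, g n ω, x n ω)) ∂(gaussianReal 0 v) ∂P := by
        rw [← lintegral_map hH (hε.prodMk hpast), hprod, lintegral_prod_symm _ hH.aemeasurable,
          lintegral_map hH.lintegral_prod_left' hpast]
    _ = _ := by
        refine lintegral_congr fun ω => ?_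
        have hF1 : Measurable (fun y => F (Fin.snoc (α := fun _ => S × ℝ) (D ω) (x n ω, y), f ω)) :=
          hF.comp ((measurable_snoc.comp (by fun_prop :
            Measurable fun y : ℝ => (D ω, x n ω, y))).prodMk measurable_const)
        have h := gaussianReal_map_const_add (μ := 0) (v := v) (f ω (x n ω))
        rw [zero_add] at h
        have h2 : ∫⁻ e, H (e, (f ω, D ω, g n ω, x n ω)) ∂(gaussianReal 0 v) =
            ∫⁻ y, F (Fin.snoc (α := fun _ => S × ℝ) (D ω) (x n ω, y), f ω)
              ∂(gaussianReal (f ω (x n ω)) v) := by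
          rw [← h, lintegral_map hF1 (by fun_prop)]
        rw [h2, gaussianReal_of_var_ne_zero _ hv, lintegral_withDensity_eq_lintegral_mul _
          (measurable_gaussianPDF _ _) hF1]
        rfl

variable [Nonempty S]

/-- Given the data, the query is independent of the function: it may be redrawn from its
conditional law. -/
lemma IsRun.lintegral_query (hrun : IsRun P f v x ε g) (hf : Measurable f)
    {G : (Fin n → S × ℝ) × S × C(S, ℝ) → ℝ≥0∞} (hG : Measurable G) :
    ∫⁻ ω, G (data f x ε n ω, x n ω, f ω) ∂P =
      ∫⁻ ω, ∫⁻ s, G (data f x ε n ω, s, f ω)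
        ∂(condDistrib (x n) (data f x ε n) P (data f x ε n ω)) ∂P := by
  have hD := hrun.measurable_data hf n
  have hx := hrun.measurable_x n
  set D := data f x ε n
  set κ := condDistrib f D P
  set η := condDistrib (x n) D P
  have hDf : P.map (fun ω => (D ω, f ω)) = P.map D ⊗ₘ κ :=
    (compProd_map_condDistrib hf.aemeasurable).symm
  have hDx : P.map (fun ω => (D ω, x n ω)) = P.map D ⊗ₘ η :=
    (compProd_map_condDistrib hx.aemeasurable).symm
  have hpeek := (hrun.no_peeking n).map_eq
  have hgx := (hrun.measurable_g n).prodMk hx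
  -- integrate over the function, then over the query
  have h1 : ∫⁻ ω, G (D ω, x n ω, f ω) ∂P = ∫⁻ ω, ∫⁻ h, G (D ω, x n ω, h) ∂(κ (D ω)) ∂P := by
    have hG1 : Measurable (fun p : ((Fin n → S × ℝ) × (C(S, ℝ) × S)) × C(S, ℝ) =>
        G (p.1.1, p.1.2.2, p.2)) := hG.comp (by fun_prop)
    have h2 := congrArg (fun μ : Measure (((Fin n → S × ℝ) × (C(S, ℝ) × S)) × C(S, ℝ)) =>
      ∫⁻ p, G (p.1.1, p.1.2.2, p.2) ∂μ) hpeek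
    simp only at h2
    rw [lintegral_map hG1 ((hD.prodMk hgx).prodMk hf), Measure.lintegral_compProd hG1,
      lintegral_map (hG1.lintegral_kernel_prod_right') (hD.prodMk hgx)] at h2
    exact h2
  have h3 : ∫⁻ ω, ∫⁻ h, G (D ω, x n ω, h) ∂(κ (D ω)) ∂P =
      ∫⁻ d, ∫⁻ s, ∫⁻ h, G (d, s, h) ∂(κ d) ∂(η d) ∂(P.map D) := by
    have hG2 : Measurable (fun q : (Fin n → S × ℝ) × S => ∫⁻ h, G (q.1, q.2, h) ∂(κ q.1)) := by
      have hG1 : Measurable (fun p : ((Fin n → S × ℝ) × S) × C(S, ℝ) =>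
        G (p.1.1, p.1.2, p.2)) := hG.comp (by fun_prop)
      exact hG1.lintegral_kernel_prod_right' (κ := Kernel.prodMkRight S κ)
    rw [← Measure.lintegral_compProd hG2, ← hDx, lintegral_map hG2 (hD.prodMk hx)]
  have h4 : ∫⁻ ω, ∫⁻ s, G (D ω, s, f ω) ∂(η (D ω)) ∂P =
      ∫⁻ d, ∫⁻ h, ∫⁻ s, G (d, s, h) ∂(η d) ∂(κ d) ∂(P.map D) := by
    have hG2 : Measurable (fun q : (Fin n → S × ℝ) × C(S, ℝ) =>
        ∫⁻ s, G (q.1, s, q.2) ∂(η q.1)) := by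
      have hG1 : Measurable (fun p : ((Fin n → S × ℝ) × C(S, ℝ)) × S =>
        G (p.1.1, p.2, p.1.2)) := hG.comp (by fun_prop)
      exact hG1.lintegral_kernel_prod_right' (κ := Kernel.prodMkRight C(S, ℝ) η)
    rw [← Measure.lintegral_compProd hG2, ← hDf, lintegral_map hG2 (hD.prodMk hf)]
  rw [h1, h3, h4]
  refine lintegral_congr fun d => lintegral_lintegral_swap ?_
  exact (hG.comp (by fun_prop : Measurable fun q : S × C(S, ℝ) => (d, q.1, q.2))).aemeasurable

lemma lintegral_mul_lintegral_lintegral {H A B : Type*} [MeasurableSpace H] [MeasurableSpace A]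
    [MeasurableSpace B] {μ : Measure H} {η : Measure A} {τ : Measure B} [SFinite μ] [SFinite η]
    [SFinite τ] {c : H → ℝ≥0∞} {W : (A × B) × H → ℝ≥0∞} (hc : Measurable c) (hW : Measurable W) :
    ∫⁻ h, c h * ∫⁻ s, ∫⁻ y, W ((s, y), h) ∂τ ∂η ∂μ =
      ∫⁻ s, ∫⁻ y, ∫⁻ h, c h * W ((s, y), h) ∂μ ∂τ ∂η := by
  have hW' (h : H) : Measurable (fun p : A × B => W (p, h)) := hW.comp (by fun_prop)
  have hcW : Measurable (fun q : (A × B) × H => c q.2 * W q) := (hc.comp measurable_snd).mul hW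
  calc ∫⁻ h, c h * ∫⁻ s, ∫⁻ y, W ((s, y), h) ∂τ ∂η ∂μ
      = ∫⁻ h, ∫⁻ p, c h * W (p, h) ∂(η.prod τ) ∂μ := by
        refine lintegral_congr fun h => ?_
        rw [lintegral_const_mul _ (hW' h), lintegral_prod _ (hW' h).aemeasurable]
    _ = ∫⁻ p, ∫⁻ h, c h * W (p, h) ∂μ ∂(η.prod τ) :=
        lintegral_lintegral_swap (hcW.comp measurable_swap).aemeasurable
    _ = _ := lintegral_prod _ hcW.lintegral_prod_right'.aemeasurable

/-- Tonelli's theorem for a product of three measures and a kernel: integrate over `H` first. -/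
lemma lintegral_mul_lintegral_compProd {D H A B : Type*} [MeasurableSpace D] [MeasurableSpace H]
    [MeasurableSpace A] [MeasurableSpace B] {ρ : Measure D} {μ : Measure H} {η : Kernel D A}
    {τ : Measure B} [SFinite ρ] [SFinite μ] [IsSFiniteKernel η] [SFinite τ]
    {c : D × H → ℝ≥0∞} {W : ((D × A) × B) × H → ℝ≥0∞} (hc : Measurable c) (hW : Measurable W) :
    ∫⁻ d, ∫⁻ h, c (d, h) * ∫⁻ s, ∫⁻ y, W (((d, s), y), h) ∂τ ∂(η d) ∂μ ∂ρ =
      ∫⁻ q, ∫⁻ h, c (q.1.1, h) * W (q, h) ∂μ ∂((ρ ⊗ₘ η).prod τ) := by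
  have hcW : Measurable (fun q : ((D × A) × B) × H => c (q.1.1.1, q.2) * W q) :=
    (hc.comp (by fun_prop : Measurable fun q : ((D × A) × B) × H => (q.1.1.1, q.2))).mul hW
  have h1 := hcW.lintegral_prod_right' (ν := μ)
  rw [lintegral_prod _ h1.aemeasurable, Measure.lintegral_compProd h1.lintegral_prod_right']
  refine lintegral_congr fun d => ?_
  exact lintegral_mul_lintegral_lintegral (c := fun h => c (d, h))
    (W := fun p : (A × B) × H => W (((d, p.1.1), p.1.2), p.2)) (hc.comp (by fun_prop))
    (hW.comp (by fun_prop : Measurable fun p : (A × B) × H => (((d, p.1.1), p.1.2), p.2)))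

/-- The joint law of the data and the function has the likelihood as density with respect to the
product of some measure and the prior. Each round contributes to this measure the conditional law of
the query given the data, which does not involve the function, and the Lebesgue measure of the
observation. -/
lemma IsRun.exists_density (hrun : IsRun P f v x ε g) (hf : Measurable f) (hv : v ≠ 0) (n : ℕ) :
    ∃ ρ : Measure (Fin n → S × ℝ), SFinite ρ ∧
      ∀ F : (Fin n → S × ℝ) × C(S, ℝ) → ℝ≥0∞, Measurable F →
        ∫⁻ ω, F (data f x ε n ω, f ω) ∂P =
          ∫⁻ d, ∫⁻ h, ENNReal.ofReal (dataLikelihood v d h) * F (d, h) ∂(P.map f) ∂ρ := by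
  induction n with
  | zero =>
    refine ⟨Measure.dirac default, inferInstance, fun F hF => ?_⟩
    have hF1 : Measurable (fun h => F (default, h)) := hF.comp (by fun_prop)
    rw [lintegral_dirac]
    simp only [dataLikelihood, gaussianLikelihood, Finset.univ_eq_empty, Finset.prod_empty,
      ENNReal.ofReal_one, one_mul]
    rw [lintegral_map hF1 hf]
    exact lintegral_congr fun ω => by rw [Subsingleton.elim (data f x ε 0 ω) default]
  | succ n ih =>
    obtain ⟨ρ, hρ, hρF⟩ := ih
    have hD := hrun.measurable_data hf n
    set η := condDistrib (x n) (data f x ε n) P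
    have := Measure.isProbabilityMeasure_map (μ := P) hf.aemeasurable
    refine ⟨((ρ ⊗ₘ η).prod volume).map fun q =>
      Fin.snoc (α := fun _ => S × ℝ) q.1.1 (q.1.2, q.2), inferInstance, fun F hF => ?_⟩
    have hL := (measurable_dataLikelihood (S := S) (n := n) v).ennreal_ofReal
    have hpdf : Measurable (fun p : ℝ × ℝ => gaussianPDFReal p.1 v p.2) :=
      (continuous_gaussianPDFReal v).measurable
    -- the integrand as a function of the old data, the query, the observation and the function
    let W : (((Fin n → S × ℝ) × S) × ℝ) × C(S, ℝ) → ℝ≥0∞ := fun q =>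
      ENNReal.ofReal (gaussianPDFReal (q.2 q.1.1.2) v q.1.2) *
        F (Fin.snoc (α := fun _ => S × ℝ) q.1.1.1 (q.1.1.2, q.1.2), q.2)
    have hsnoc : Measurable (fun q : ((Fin n → S × ℝ) × S) × ℝ =>
        (Fin.snoc (α := fun _ => S × ℝ) q.1.1 (q.1.2, q.2) : Fin (n + 1) → S × ℝ)) :=
      measurable_snoc.comp (by fun_prop : Measurable
        fun q : ((Fin n → S × ℝ) × S) × ℝ => (q.1.1, q.1.2, q.2))
    have hW : Measurable W := by
      have he : Measurable (fun q : (((Fin n → S × ℝ) × S) × ℝ) × C(S, ℝ) =>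
          q.2 q.1.1.2) := measurable_eval_pair.comp (by fun_prop : Measurable
            fun q : (((Fin n → S × ℝ) × S) × ℝ) × C(S, ℝ) => (q.2, q.1.1.2))
      refine Measurable.mul (Measurable.ennreal_ofReal ?_) ?_
      · exact Measurable.comp (g := fun p : ℝ × ℝ => gaussianPDFReal p.1 v p.2)
          (f := fun q : (((Fin n → S × ℝ) × S) × ℝ) × C(S, ℝ) => (q.2 q.1.1.2, q.1.2)) hpdf
          (he.prodMk (by fun_prop))
      · exact hF.comp ((hsnoc.comp measurable_fst).prodMk measurable_snd)
    let G : (Fin n → S × ℝ) × S × C(S, ℝ) → ℝ≥0∞ := fun p => ∫⁻ y, W (((p.1, p.2.1), y), p.2.2)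
    have hG : Measurable G := by
      have h1 : Measurable (fun q : ((Fin n → S × ℝ) × S × C(S, ℝ)) × ℝ =>
        W (((q.1.1, q.1.2.1), q.2), q.1.2.2)) := hW.comp (by fun_prop)
      exact h1.lintegral_prod_right'
    have hG2 : Measurable (fun q : (Fin n → S × ℝ) × C(S, ℝ) =>
        ∫⁻ s, G (q.1, s, q.2) ∂(η q.1)) := by
      have hG1 : Measurable (fun p : ((Fin n → S × ℝ) × C(S, ℝ)) × S =>
        G (p.1.1, p.2, p.1.2)) := hG.comp (by fun_prop)
      exact hG1.lintegral_kernel_prod_right' (κ := Kernel.prodMkRight C(S, ℝ) η)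
    have hrhs : Measurable (fun d => ∫⁻ h, ENNReal.ofReal (dataLikelihood v d h) * F (d, h)
        ∂(P.map f)) :=
      ((measurable_dataLikelihood v).ennreal_ofReal.mul hF).lintegral_prod_right'
    calc ∫⁻ ω, F (data f x ε (n + 1) ω, f ω) ∂P
        = ∫⁻ ω, G (data f x ε n ω, x n ω, f ω) ∂P := hrun.lintegral_noise hf hv hF
      _ = ∫⁻ ω, ∫⁻ s, G (data f x ε n ω, s, f ω) ∂(η (data f x ε n ω)) ∂P :=
          hrun.lintegral_query hf hG
      _ = ∫⁻ d, ∫⁻ h, ENNReal.ofReal (dataLikelihood v d h) * ∫⁻ s, G (d, s, h) ∂(η d)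
            ∂(P.map f) ∂ρ := hρF _ hG2
      _ = ∫⁻ q, ∫⁻ h, ENNReal.ofReal (dataLikelihood v q.1.1 h) * W (q, h)
            ∂(P.map f) ∂((ρ ⊗ₘ η).prod volume) := lintegral_mul_lintegral_compProd hL hW
      _ = _ := by
          rw [lintegral_map hrhs hsnoc]
          refine lintegral_congr fun q => lintegral_congr fun h => ?_
          simp only [dataLikelihood_snoc, W]
          rw [ENNReal.ofReal_mul (dataLikelihood_nonneg v q.1.1 h), mul_assoc]

end Run

/-! ### The posterior law and its mean -/

section Evidence

variable {S : Type*} [TopologicalSpace S] {n : ℕ}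

/-- The evidence of the data `d`: the likelihood integrated over the prior `Q`. -/
noncomputable def evidence (Q : Measure C(S, ℝ)) (v : ℝ≥0) (d : Fin n → S × ℝ) : ℝ≥0∞ :=
  ∫⁻ h, ENNReal.ofReal (dataLikelihood v d h) ∂Q

lemma evidence_eq_ofReal (Q : Measure C(S, ℝ)) [IsFiniteMeasure Q] (v : ℝ≥0)
    (d : Fin n → S × ℝ) :
    evidence Q v d = ENNReal.ofReal (∫ h, dataLikelihood v d h ∂Q) :=
  (ofReal_integral_eq_lintegral_ofReal (integrable_likelihood v _ _)
    (ae_of_all _ fun h => dataLikelihood_nonneg v d h)).symm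

lemma evidence_ne_top (Q : Measure C(S, ℝ)) [IsFiniteMeasure Q] (v : ℝ≥0) (d : Fin n → S × ℝ) :
    evidence Q v d ≠ ∞ := by
  rw [evidence_eq_ofReal]
  exact ENNReal.ofReal_ne_top

end Evidence

lemma IsGPPrior.integrable_norm_comp {Ω S : Type*} [MeasurableSpace Ω] [MetricSpace S]
    [CompactSpace S] [Nonempty S] {P : Measure Ω} {f : Ω → C(S, ℝ)} {k : S → S → ℝ}
    (hf : IsGPPrior P f k) : Integrable (fun ω => ‖f ω‖) P :=
  hf.map.integrable_norm.comp_measurable hf.measurable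

section Posterior

variable {S : Type*} [MetricSpace S] [CompactSpace S] [MeasurableSpace S] [BorelSpace S]
  {n : ℕ} {v : ℝ≥0}

lemma measurable_evidence (Q : Measure C(S, ℝ)) [SFinite Q] (v : ℝ≥0) :
    Measurable (evidence (n := n) Q v) :=
  (measurable_dataLikelihood v).ennreal_ofReal.lintegral_prod_right'

lemma measurable_dataLikelihood_right (v : ℝ≥0) (d : Fin n → S × ℝ) :
    Measurable (dataLikelihood v d) :=
  Measurable.comp (g := fun p : (Fin n → S × ℝ) × C(S, ℝ) => dataLikelihood v p.1 p.2)
    (f := fun h => (d, h)) (measurable_dataLikelihood v) measurable_prodMk_left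

lemma evidence_ne_zero (Q : Measure C(S, ℝ)) [NeZero Q] (hv : v ≠ 0) (d : Fin n → S × ℝ) :
    evidence Q v d ≠ 0 := by
  intro h0
  rw [evidence, lintegral_eq_zero_iff (measurable_dataLikelihood_right v d).ennreal_ofReal] at h0
  have : ∀ᵐ h ∂Q, False := by
    filter_upwards [h0] with h hh
    exact (ENNReal.ofReal_pos.2 (gaussianLikelihood_pos hv _ _)).ne' hh
  exact NeZero.ne Q (ae_eq_bot.1 (Filter.eventually_false_iff_eq_bot.1 this))

lemma measurable_dataLikelihood_div_evidence (Q : Measure C(S, ℝ)) [SFinite Q] (v : ℝ≥0) :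
    Measurable (Function.uncurry fun (d : Fin n → S × ℝ) (h : C(S, ℝ)) =>
      ENNReal.ofReal (dataLikelihood v d h) / evidence Q v d) :=
  (measurable_dataLikelihood v).ennreal_ofReal.div ((measurable_evidence Q v).comp measurable_fst)

/-- Bayes' rule: the posterior has the normalized likelihood as density with respect to the prior
`Q`. -/
noncomputable def posteriorKernel (Q : Measure C(S, ℝ)) [SFinite Q] (v : ℝ≥0) (n : ℕ) :
    Kernel (Fin n → S × ℝ) C(S, ℝ) :=
  Kernel.withDensity (Kernel.const _ Q)
    fun d h => ENNReal.ofReal (dataLikelihood v d h) / evidence Q v d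

lemma posteriorKernel_apply (Q : Measure C(S, ℝ)) [SFinite Q] (v : ℝ≥0) (d : Fin n → S × ℝ) :
    posteriorKernel Q v n d =
      Q.withDensity fun h => ENNReal.ofReal (dataLikelihood v d h) / evidence Q v d :=
  Kernel.withDensity_apply _ (measurable_dataLikelihood_div_evidence Q v) d

lemma lintegral_posteriorKernel (Q : Measure C(S, ℝ)) [SFinite Q] (v : ℝ≥0) (d : Fin n → S × ℝ)
    {F : C(S, ℝ) → ℝ≥0∞} (hF : Measurable F) :
    ∫⁻ h, F h ∂(posteriorKernel Q v n d) =
      (∫⁻ h, ENNReal.ofReal (dataLikelihood v d h) * F h ∂Q) / evidence Q v d := by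
  have hL := (measurable_dataLikelihood_right v d).ennreal_ofReal
  rw [posteriorKernel_apply, lintegral_withDensity_eq_lintegral_mul _ (hL.div_const _) hF]
  simp only [Pi.mul_apply, div_eq_mul_inv]
  rw [← lintegral_mul_const _ (by exact hL.mul hF)]
  exact lintegral_congr fun h => by ring

lemma isMarkovKernel_posteriorKernel (Q : Measure C(S, ℝ)) [IsProbabilityMeasure Q] (hv : v ≠ 0) :
    IsMarkovKernel (posteriorKernel Q v n) := by
  refine ⟨fun d => ⟨?_⟩⟩
  rw [← lintegral_one, lintegral_posteriorKernel Q v d measurable_const]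
  simp only [mul_one]
  exact ENNReal.div_self (evidence_ne_zero Q hv d) (evidence_ne_top Q v d)

variable {Ω : Type*} [MeasurableSpace Ω] {P : Measure Ω} [IsProbabilityMeasure P]
  {f : Ω → C(S, ℝ)} {x : ℕ → Ω → S} {ε : ℕ → Ω → ℝ} {g : ℕ → Ω → C(S, ℝ)}

/-- The posterior sample path has the prior as its unconditional law. -/
lemma IsRun.map_sample (hrun : IsRun P f v x ε g) (hf : Measurable f) (n : ℕ) :
    P.map (g n) = P.map f := by
  have hD := hrun.measurable_data hf n
  have h1 := (hrun.sample_law n).map_eq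
  rw [compProd_map_condDistrib hf.aemeasurable] at h1
  have h2 := congrArg (Measure.map Prod.snd) h1
  rw [Measure.map_map measurable_snd (hD.prodMk (hrun.measurable_g n)),
    Measure.map_map measurable_snd (hD.prodMk hf)] at h2
  exact h2

lemma IsRun.measurable_eval_query (hrun : IsRun P f v x ε g) (hf : Measurable f) (n : ℕ) :
    Measurable (fun ω => f ω (x n ω)) :=
  measurable_eval_pair.comp (hf.prodMk (hrun.measurable_x n))

variable [Nonempty S] {k : S → S → ℝ} {Q : Measure C(S, ℝ)}

/-- The mean of the posterior at a point is the posterior mean of Gaussian process regression. -/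
lemma IsGPPrior.integral_posteriorKernel [SFinite Q] (hQ : IsGPPrior Q (fun h => h) k) (hv : v ≠ 0)
    (d : Fin n → S × ℝ) (z : S) :
    ∫ h, h z ∂(posteriorKernel Q v n d) = posteriorMean k v d z := by
  have := hQ.isProbabilityMeasure
  have hL := (measurable_dataLikelihood_right v d).ennreal_ofReal
  have h0 := evidence_ne_zero Q hv d
  rw [evidence_eq_ofReal, ne_eq, ENNReal.ofReal_eq_zero, not_le] at h0
  rw [posteriorKernel_apply, integral_withDensity_eq_integral_toReal_smul (hL.div_const _)
    (ae_of_all _ fun h => ENNReal.div_lt_top ENNReal.ofReal_ne_top (evidence_ne_zero Q hv d))]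
  have h1 (h : C(S, ℝ)) : (ENNReal.ofReal (dataLikelihood v d h) / evidence Q v d).toReal • h z =
      (h z * gaussianLikelihood v (fun i => h (d i).1) (fun i => (d i).2)) *
        (∫ h, dataLikelihood v d h ∂Q)⁻¹ := by
    rw [evidence_eq_ofReal, ENNReal.toReal_div, ENNReal.toReal_ofReal h0.le,
      ENNReal.toReal_ofReal (dataLikelihood_nonneg _ _ _), smul_eq_mul, dataLikelihood]
    ring
  simp_rw [h1]
  rw [integral_mul_const, integral_eval_mul_likelihood hQ hv]
  exact mul_inv_cancel_right₀ h0.ne' _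

/-- Although the queries are chosen adaptively, the conditional law of the function given the data
is given by Bayes' rule. -/
lemma IsRun.condDistrib_ae_eq (hrun : IsRun P f v x ε g) (hf : Measurable f) (hv : v ≠ 0) (n : ℕ) :
    condDistrib f (data f x ε n) P =ᵐ[P.map (data f x ε n)] posteriorKernel (P.map f) v n := by
  have := Measure.isProbabilityMeasure_map (μ := P) hf.aemeasurable
  have := isMarkovKernel_posteriorKernel (n := n) (P.map f) hv
  have hD := hrun.measurable_data hf n
  obtain ⟨ρ, -, hρ⟩ := hrun.exists_density hf hv n
  refine condDistrib_ae_eq_of_measure_eq_compProd _ hf.aemeasurable ?_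
  refine Measure.ext_of_lintegral _ fun F hF => ?_
  have hΦ : Measurable fun d => ∫⁻ h, F (d, h) ∂(posteriorKernel (P.map f) v n d) :=
    hF.lintegral_kernel_prod_right'
  rw [lintegral_map hF (hD.prodMk hf), Measure.lintegral_compProd hF, lintegral_map hΦ hD, hρ F hF,
    hρ (fun p => ∫⁻ h, F (p.1, h) ∂(posteriorKernel (P.map f) v n p.1)) (hΦ.comp measurable_fst)]
  refine lintegral_congr fun d => ?_
  dsimp only
  rw [lintegral_mul_const _ (measurable_dataLikelihood_right v d).ennreal_ofReal]
  change _ = evidence (P.map f) v d * _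
  have hFd : Measurable (fun h => F (d, h)) := hF.comp measurable_prodMk_left
  rw [lintegral_posteriorKernel _ _ _ hFd, ENNReal.mul_div_cancel
    (evidence_ne_zero _ hv d) (evidence_ne_top _ v d)]

lemma IsRun.ae_integral_condDistrib (hrun : IsRun P f v x ε g) (hf : IsGPPrior P f k) (hv : v ≠ 0)
    (n : ℕ) : ∀ᵐ ω ∂P, ∀ z, ∫ h, h z ∂(condDistrib f (data f x ε n) P (data f x ε n ω)) =
      posteriorMean k v (data f x ε n ω) z := by
  have := Measure.isProbabilityMeasure_map (μ := P) hf.measurable.aemeasurable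
  filter_upwards [ae_of_ae_map (hrun.measurable_data hf.measurable n).aemeasurable
    (hrun.condDistrib_ae_eq hf.measurable hv n)] with ω hω z
  rw [hω, hf.map.integral_posteriorKernel hv]

lemma IsRun.integrable_eval_query (hrun : IsRun P f v x ε g) (hf : IsGPPrior P f k) (n : ℕ) :
    Integrable (fun ω => f ω (x n ω)) P :=
  hf.integrable_norm_comp.mono' (hrun.measurable_eval_query hf.measurable n).aestronglyMeasurable
    (ae_of_all _ fun ω => (f ω).norm_coe_le_norm _)

/-- The value at the query and the posterior mean there have the same expectation, since the query
depends on the function only through the data. -/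
lemma IsRun.integral_eval_query (hrun : IsRun P f v x ε g) (hf : IsGPPrior P f k) (hv : v ≠ 0)
    (n : ℕ) : Integrable (fun ω => posteriorMean k v (data f x ε n ω) (x n ω)) P ∧
      ∫ ω, f ω (x n ω) ∂P = ∫ ω, posteriorMean k v (data f x ε n ω) (x n ω) ∂P := by
  have hD := hrun.measurable_data hf.measurable n
  have hx := hrun.measurable_x n
  set D := data f x ε n
  have hDgx : Measurable (fun ω => (D ω, (g n ω, x n ω))) :=
    hD.prodMk ((hrun.measurable_g n).prodMk hx)
  let E : ((Fin n → S × ℝ) × (C(S, ℝ) × S)) × C(S, ℝ) → ℝ := fun p => p.2 p.1.2.2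
  have hE : Measurable E := measurable_eval_pair.comp (by fun_prop : Measurable
    fun p : ((Fin n → S × ℝ) × (C(S, ℝ) × S)) × C(S, ℝ) => (p.2, p.1.2.2))
  have hpeek := (hrun.no_peeking n).map_eq
  have hint : Integrable E (P.map fun ω => ((D ω, (g n ω, x n ω)), f ω)) :=
    (integrable_map_measure hE.aestronglyMeasurable
      (hDgx.prodMk hf.measurable).aemeasurable).2 (hrun.integrable_eval_query hf n)
  have heq : ∫ p, E p ∂(P.map fun ω => ((D ω, (g n ω, x n ω)), f ω)) = ∫ ω, f ω (x n ω) ∂P :=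
    integral_map (hDgx.prodMk hf.measurable).aemeasurable hE.aestronglyMeasurable
  rw [hpeek] at hint heq
  have hint2 : Integrable (fun p : (Fin n → S × ℝ) × (C(S, ℝ) × S) =>
      ∫ h, E (p, h) ∂(condDistrib f D P p.1)) (P.map fun ω => (D ω, (g n ω, x n ω))) :=
    MeasureTheory.Integrable.integral_compProd hint
  have hae : (fun ω => ∫ h, E ((D ω, (g n ω, x n ω)), h) ∂(condDistrib f D P (D ω))) =ᵐ[P]
      fun ω => posteriorMean k v (D ω) (x n ω) := by
    filter_upwards [hrun.ae_integral_condDistrib hf hv n] with ω hω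
    exact hω (x n ω)
  refine ⟨((integrable_map_measure hint2.aestronglyMeasurable hDgx.aemeasurable).1
    hint2).congr hae, ?_⟩
  rw [← heq, Measure.integral_compProd hint]
  exact (integral_map hDgx.aemeasurable hint2.aestronglyMeasurable).trans (integral_congr_ae hae)

end Posterior

/-! ### The maximum of a sample path and the query rule -/

lemma maxValue_zero {S : Type*} [TopologicalSpace S] [Nonempty S] :
    maxValue (0 : C(S, ℝ)) = 0 := by simp [maxValue]

section MaxValue

variable {S : Type*} [TopologicalSpace S] [CompactSpace S]

lemma bddAbove_range_coe (h : C(S, ℝ)) : BddAbove (Set.range h) :=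
  (isCompact_range h.continuous).bddAbove

variable [Nonempty S]

lemma lipschitzWith_maxValue : LipschitzWith 1 (maxValue : C(S, ℝ) → ℝ) := by
  refine LipschitzWith.of_le_add fun h h' => ciSup_le fun z => ?_
  have h1 : h' z ≤ maxValue h' := le_ciSup (bddAbove_range_coe h') z
  have h2 := (le_abs_self (h z - h' z)).trans
    (ContinuousMap.dist_apply_le_dist (f := h) (g := h') z)
  linarith

lemma measurable_maxValue : Measurable (maxValue : C(S, ℝ) → ℝ) :=
  lipschitzWith_maxValue.continuous.measurable

lemma norm_maxValue_le (h : C(S, ℝ)) : ‖maxValue h‖ ≤ ‖h‖ := by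
  simpa [maxValue_zero] using lipschitzWith_maxValue.dist_le_mul h 0

end MaxValue

lemma expectedImprovement_zero (m u : ℝ) : expectedImprovement m 0 u = max (m - u) 0 := by
  simp [expectedImprovement]

/-- A Gaussian variable of positive variance exceeds any reference value with positive
probability. -/
lemma expectedImprovement_pos {w : ℝ} (hw : 0 < w) (m u : ℝ) : 0 < expectedImprovement m w u := by
  have hw' : w.toNNReal ≠ 0 := by simpa using hw
  have hint : Integrable (fun z => max (z - u) 0) (gaussianReal m w.toNNReal) :=
    (((memLp_id_gaussianReal 1).integrable (by simp)).sub (integrable_const u)).pos_part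
  refine (integral_pos_iff_support_of_nonneg (fun z => le_max_right _ _) hint).2 ?_
  have hsupp : Function.support (fun z : ℝ => max (z - u) 0) = Set.Ioi u := by
    ext z
    simp
  change 0 < gaussianReal m w.toNNReal (Function.support fun z : ℝ => max (z - u) 0)
  rw [hsupp, pos_iff_ne_zero]
  intro h0
  simpa using gaussianReal_absolutelyContinuous' m hw' h0

section Continuity

variable {S : Type*} [MetricSpace S] [CompactSpace S] [Nonempty S]
  {n : ℕ} {k : S → S → ℝ} {Q : Measure C(S, ℝ)} {v : ℝ}

lemma IsGPPrior.continuous_posteriorVar (hQ : IsGPPrior Q (fun h => h) k) (hv : 0 < v) :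
    Continuous (fun p : (Fin n → S × ℝ) × S => posteriorVar k v p.1 p.2) := by
  have hk {X : Type _} [TopologicalSpace X] {a b : X → S} (ha : Continuous a) (hb : Continuous b) :
      Continuous (fun p => k (a p) (b p)) := hQ.continuous_kernel.comp (ha.prodMk hb)
  have hM : Continuous (fun p : (Fin n → S × ℝ) × S => regKernelMatrix k v fun i => (p.1 i).1) :=
    (continuous_matrix fun i j => hk (by fun_prop) (by fun_prop)).add continuous_const
  have hinv : Continuous (fun p : (Fin n → S × ℝ) × S =>
      (regKernelMatrix k v fun i => (p.1 i).1)⁻¹) := by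
    simp_rw [Matrix.inv_def, Ring.inverse_eq_inv']
    exact (hM.matrix_det.inv₀ fun p => (hQ.posDef hv _).det_pos.ne').smul hM.matrix_adjugate
  have hvec : Continuous (fun (p : (Fin n → S × ℝ) × S) i => k p.2 (p.1 i).1) :=
    continuous_pi fun i => hk (by fun_prop) (by fun_prop)
  exact (hk (by fun_prop) (by fun_prop)).sub (hvec.dotProduct (hinv.matrix_mulVec hvec))

end Continuity

/-! ### Regret and information gain -/

/-- The posterior variances at the queried points are bounded by the information gain, whatever the
queries are. -/
lemma IsGPPrior.sum_posteriorStd_sq_le {Ω S : Type*} [MeasurableSpace Ω] [TopologicalSpace S]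
    [Nonempty S] {P : Measure Ω} {f : Ω → C(S, ℝ)} {v : ℝ≥0} {k : S → S → ℝ}
    (hf : IsGPPrior P f k) (hk : ∀ z, k z z ≤ 1) (hv : v ≠ 0) (x : ℕ → Ω → S)
    (ε : ℕ → Ω → ℝ) (T : ℕ) (ω : Ω) :
    ∑ n ∈ Finset.range T,
        ENNReal.ofReal (posteriorStd k v (data f x ε n ω) (x n ω)) ^ (2 : ℝ) ≤
      ENNReal.ofReal (2 / Real.log (1 + (v : ℝ)⁻¹)) * maxInformationGain (P.map f) v T := by
  have h0 (n : ℕ) : 0 ≤ posteriorVar k v (data f x ε n ω) (x n ω) :=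
    hf.map.posteriorVar_nonneg (by positivity) _ _
  refine Eq.trans_le ?_ (hf.map.sum_posteriorVar_le hk hv
    (fun i => (x i ω, f ω (x i ω) + ε i ω)) T)
  refine Eq.trans ?_ (ENNReal.ofReal_sum_of_nonneg fun n _ => h0 n).symm
  refine Finset.sum_congr rfl fun n _ => ?_
  rw [ENNReal.rpow_two, posteriorStd, ← ENNReal.ofReal_pow (Real.sqrt_nonneg _)]
  exact congrArg _ (Real.sq_sqrt (h0 n))

section Regret

variable {Ω S : Type*} [MeasurableSpace Ω] [MetricSpace S] [CompactSpace S] [Nonempty S]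
  [MeasurableSpace S] [BorelSpace S] {P : Measure Ω} [IsProbabilityMeasure P]
  {f : Ω → C(S, ℝ)} {v : ℝ≥0} {k : S → S → ℝ} {x : ℕ → Ω → S} {ε : ℕ → Ω → ℝ}
  {g : ℕ → Ω → C(S, ℝ)}

lemma IsRun.aemeasurable_eta (hrun : IsRun P f v x ε g) (hf : IsGPPrior P f k) (hv : v ≠ 0)
    (n : ℕ) : AEMeasurable (eta k v f x ε g n) P := by
  have hvar : Measurable (fun ω => posteriorVar k v (data f x ε n ω) (x n ω)) :=
    (hf.map.continuous_posteriorVar (by positivity)).measurable.comp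
      ((hrun.measurable_data hf.measurable n).prodMk (hrun.measurable_x n))
  exact ((measurable_maxValue.comp (hrun.measurable_g n)).aemeasurable.sub
    (hrun.integral_eval_query hf hv n).1.aemeasurable).div hvar.sqrt.aemeasurable

/-- The maxima of the function and of the posterior sample path have the same law. -/
lemma IsRun.integrable_maxValue (hrun : IsRun P f v x ε g) (hf : IsGPPrior P f k) (n : ℕ) :
    Integrable (fun ω => maxValue (f ω)) P ∧ Integrable (fun ω => maxValue (g n ω)) P ∧
      ∫ ω, maxValue (g n ω) ∂P = ∫ ω, maxValue (f ω) ∂P := by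
  have hm := measurable_maxValue (S := S)
  have h1 : Integrable (fun ω => maxValue (f ω)) P := hf.integrable_norm_comp.mono'
    (hm.comp hf.measurable).aestronglyMeasurable (ae_of_all _ fun ω => norm_maxValue_le _)
  have h2 : Integrable maxValue (P.map f) :=
    (integrable_map_measure hm.aestronglyMeasurable hf.measurable.aemeasurable).2 h1
  refine ⟨h1, ?_, ?_⟩
  · rw [← hrun.map_sample hf.measurable n] at h2
    exact h2.comp_measurable (hrun.measurable_g n)
  · rw [← integral_map (hrun.measurable_g n).aemeasurable hm.aestronglyMeasurable,
      hrun.map_sample hf.measurable, integral_map hf.measurable.aemeasurable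
      hm.aestronglyMeasurable]

/-- The expected regret of a round. The maximum of `f` may be replaced by the maximum of the
posterior sample path, which has the same law, and the value `f(x n)` by the posterior mean. -/
lemma IsRun.integral_regret (hrun : IsRun P f v x ε g) (hf : IsGPPrior P f k) (hv : v ≠ 0)
    (n : ℕ) : Integrable (regret f x n) P ∧
      Integrable (fun ω => maxValue (g n ω) - posteriorMean k v (data f x ε n ω) (x n ω)) P ∧
      ∫ ω, regret f x n ω ∂P =
        ∫ ω, (maxValue (g n ω) - posteriorMean k v (data f x ε n ω) (x n ω)) ∂P := by
  obtain ⟨h1, h2, h3⟩ := hrun.integrable_maxValue hf n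
  obtain ⟨h4, h5⟩ := hrun.integral_eval_query hf hv n
  have h6 := hrun.integrable_eval_query hf n
  refine ⟨h1.sub h6, h2.sub h4, ?_⟩
  rw [integral_sub h2 h4, h3, ← h5]
  exact integral_sub h1 h6

/-- A query without posterior uncertainty reaches the maximum of the posterior sample path. For
GP-EIMS, a query of vanishing expected improvement is possible only if the prior variance vanishes
everywhere, and then the sample path is zero. -/
lemma IsRun.ae_maxValue_le (hrun : IsRun P f v x ε g) (hf : IsGPPrior P f k) (hv : v ≠ 0)
    (hrule : IsGPEIMS k v f x ε g ∨ ∀ z, 0 < k z z) (n : ℕ) :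
    ∀ᵐ ω ∂P, posteriorVar k v (data f x ε n ω) (x n ω) = 0 →
      maxValue (g n ω) ≤ posteriorMean k v (data f x ε n ω) (x n ω) := by
  have hQ := hf.map
  have hv' : 0 < (v : ℝ) := by positivity
  have hmean {z : S} (hz : k z z = 0) (d : Fin n → S × ℝ) : posteriorMean k v d z = 0 := by
    simp [posteriorMean, hQ.kernel_eq_zero hz, dotProduct]
  rcases hrule with hei | hpos
  · by_cases hk0 : ∀ z, k z z = 0
    · have h0 := hQ.ae_eq_zero hk0
      rw [← hrun.map_sample hf.measurable n] at h0
      filter_upwards [ae_of_ae_map (hrun.measurable_g n).aemeasurable h0] with ω hω _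
      rw [hω, maxValue_zero, hmean (hk0 _)]
    · obtain ⟨z, hz⟩ := not_forall.1 hk0
      refine ae_of_all _ fun ω h0 => ?_
      by_contra! hlt
      have hEI := hei n ω (Set.mem_univ z)
      simp only [Set.mem_ofPred_eq] at hEI
      rw [h0, expectedImprovement_zero, max_eq_right (by linarith)] at hEI
      refine (expectedImprovement_pos ?_ _ _).not_ge hEI
      exact (hQ.posteriorVar_nonneg hv' _ _).lt_of_ne'
        fun h => hz (hQ.kernel_self_eq_zero_of_posteriorVar hv' _ _ h)
  · exact ae_of_all _ fun ω h0 =>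
      absurd (hQ.kernel_self_eq_zero_of_posteriorVar hv' _ _ h0) (hpos _).ne'

/-- The gap between the maximum of the posterior sample path and the posterior mean at the query is
at most the positive part of `η` times the posterior standard deviation there. -/
lemma IsRun.ae_gap_le (hrun : IsRun P f v x ε g) (hf : IsGPPrior P f k) (hv : v ≠ 0)
    (hrule : IsGPEIMS k v f x ε g ∨ ∀ z, 0 < k z z) (n : ℕ) :
    ∀ᵐ ω ∂P, maxValue (g n ω) - posteriorMean k v (data f x ε n ω) (x n ω) ≤
      max (eta k v f x ε g n ω) 0 * posteriorStd k v (data f x ε n ω) (x n ω) := by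
  filter_upwards [hrun.ae_maxValue_le hf hv hrule n] with ω hω
  -- where the posterior standard deviation vanishes, `eta` is a division by zero and says nothing
  rcases (Real.sqrt_nonneg (posteriorVar k v (data f x ε n ω) (x n ω))).eq_or_lt with h0 | h0
  · have h1 : posteriorVar k v (data f x ε n ω) (x n ω) = 0 :=
      (Real.sqrt_eq_zero (hf.map.posteriorVar_nonneg (by positivity) _ _)).1 h0.symm
    rw [posteriorStd, ← h0, mul_zero]
    linarith [hω h1]
  · calc _ = eta k v f x ε g n ω * posteriorStd k v (data f x ε n ω) (x n ω) :=
          (div_mul_cancel₀ _ h0.ne').symm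
      _ ≤ _ := mul_le_mul_of_nonneg_right (le_max_left _ _) h0.le

/-- The regret bound, by the Cauchy–Schwarz inequality first over the rounds and then over the
probability space. -/
lemma IsRun.bcr_le (hrun : IsRun P f v x ε g) (hf : IsGPPrior P f k) (hk : ∀ z, k z z ≤ 1)
    (hv : v ≠ 0) (hrule : IsGPEIMS k v f x ε g ∨ ∀ z, 0 < k z z) (T : ℕ) :
    ENNReal.ofReal (bcr P f x T) ≤
      (∫⁻ ω, ∑ n ∈ Finset.range T, ENNReal.ofReal
          (if 0 ≤ eta k v f x ε g n ω then eta k v f x ε g n ω ^ 2 else 0) ∂P) ^ (1 / 2 : ℝ) *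
        (ENNReal.ofReal (2 / Real.log (1 + (v : ℝ)⁻¹)) *
          maxInformationGain (P.map f) v T) ^ (1 / 2 : ℝ) := by
  set B := ENNReal.ofReal (2 / Real.log (1 + (v : ℝ)⁻¹)) * maxInformationGain (P.map f) v T
  let G : ℕ → Ω → ℝ := fun n ω => maxValue (g n ω) - posteriorMean k v (data f x ε n ω) (x n ω)
  let p : ℕ → Ω → ℝ≥0∞ := fun n ω => ENNReal.ofReal (eta k v f x ε g n ω)
  let s : ℕ → Ω → ℝ≥0∞ := fun n ω => ENNReal.ofReal (posteriorStd k v (data f x ε n ω) (x n ω))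
  have hp (n : ℕ) : AEMeasurable (p n) P :=
    (hrun.aemeasurable_eta hf hv n).ennreal_ofReal
  have hps (n : ℕ) (ω : Ω) : p n ω ^ (2 : ℝ) = ENNReal.ofReal
      (if 0 ≤ eta k v f x ε g n ω then eta k v f x ε g n ω ^ 2 else 0) := by
    rw [ENNReal.rpow_two]
    split_ifs with h
    · exact (ENNReal.ofReal_pow h 2).symm
    · simp [p, ENNReal.ofReal_of_nonpos (not_le.1 h).le]
  have hsum : AEMeasurable (fun ω => ∑ n ∈ Finset.range T, p n ω ^ (2 : ℝ)) P :=
    Finset.aemeasurable_fun_sum _ fun n _ => (hp n).pow_const 2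
  have hG (n : ℕ) := hrun.integral_regret hf hv n
  simp_rw [← hps]
  calc ENNReal.ofReal (bcr P f x T)
      = ∑ n ∈ Finset.range T, ENNReal.ofReal (∫ ω, regret f x n ω ∂P) :=
        ENNReal.ofReal_sum_of_nonneg fun n _ => integral_nonneg fun ω =>
          sub_nonneg.2 (le_ciSup (bddAbove_range_coe (f ω)) (x n ω))
    _ ≤ ∑ n ∈ Finset.range T, ∫⁻ ω, ENNReal.ofReal (G n ω) ∂P := by
        -- the integral of a function is at most the integral of its positive part
        refine Finset.sum_le_sum fun n _ => ?_
        rw [(hG n).2.2, integral_eq_lintegral_pos_part_sub_lintegral_neg_part (hG n).2.1]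
        exact (ENNReal.ofReal_le_ofReal (sub_le_self _ ENNReal.toReal_nonneg)).trans
          ENNReal.ofReal_toReal_le
    _ = ∫⁻ ω, ∑ n ∈ Finset.range T, ENNReal.ofReal (G n ω) ∂P :=
        (lintegral_finsetSum' _ fun n _ => (hG n).2.1.aemeasurable.ennreal_ofReal).symm
    _ ≤ ∫⁻ ω, ∑ n ∈ Finset.range T, p n ω * s n ω ∂P := by
        refine lintegral_mono_ae ?_
        filter_upwards [ae_all_iff.2 fun n => hrun.ae_gap_le hf hv hrule n] with ω hω
        refine Finset.sum_le_sum fun n _ => (ENNReal.ofReal_le_ofReal (hω n)).trans_eq ?_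
        rw [ENNReal.ofReal_mul (le_max_right _ _), ENNReal.ofReal_max, ENNReal.ofReal_zero]
        simp [p, s]
    _ ≤ ∫⁻ ω, (∑ n ∈ Finset.range T, p n ω ^ (2 : ℝ)) ^ (1 / 2 : ℝ) * B ^ (1 / 2 : ℝ) ∂P := by
        refine lintegral_mono fun ω => (ENNReal.inner_le_Lp_mul_Lq _ _ _
          Real.HolderConjugate.two_two).trans ?_
        gcongr
        exact hf.sum_posteriorStd_sq_le hk hv x ε T ω
    _ ≤ _ := by
        refine (ENNReal.lintegral_mul_le_Lp_mul_Lq P Real.HolderConjugate.two_two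
          (hsum.pow_const _) (aemeasurable_const (b := B ^ (1 / 2 : ℝ)))).trans_eq ?_
        simp_rw [← ENNReal.rpow_mul]
        simp

end Regret

end BayesOpt

theorem mainTheorem4 {Ω S : Type*} [MeasurableSpace Ω]
    [MetricSpace S] [CompactSpace S] [Nonempty S] [MeasurableSpace S] [BorelSpace S]
    (P : Measure Ω) [IsProbabilityMeasure P]
    (k : S → S → ℝ) (hk : ∀ z, k z z ≤ 1) (σ : ℝ≥0) (hσ : 0 < σ)
    (f : Ω → C(S, ℝ)) (hf : BayesOpt.IsGPPrior P f k)
    (x : ℕ → Ω → S) (ε : ℕ → Ω → ℝ) (g : ℕ → Ω → C(S, ℝ))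
    (hrun : BayesOpt.IsRun P f (σ ^ 2) x ε g)
    -- either the algorithm is GP-EIMS, or it is arbitrary and the prior variance is positive
    (hrule : BayesOpt.IsGPEIMS k ((σ : ℝ) ^ 2) f x ε g ∨ ∀ z, 0 < k z z)
    (T : ℕ) :
    (∀ n, Integrable (BayesOpt.regret f x n) P) ∧
    ENNReal.ofReal (BayesOpt.bcr P f x T) ≤
      (∫⁻ ω, ∑ n ∈ Finset.range T, ENNReal.ofReal
          (if 0 ≤ BayesOpt.eta k ((σ : ℝ) ^ 2) f x ε g n ω
            then BayesOpt.eta k ((σ : ℝ) ^ 2) f x ε g n ω ^ 2 else 0) ∂P) ^ (1 / 2 : ℝ) *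
        (ENNReal.ofReal (2 / Real.log (1 + ((σ : ℝ) ^ 2)⁻¹)) *
          BayesOpt.maxInformationGain (P.map f) (σ ^ 2) T) ^ (1 / 2 : ℝ) := by
  have hv : σ ^ 2 ≠ 0 := (pow_pos hσ 2).ne'
  have hcast : (σ : ℝ) ^ 2 = ((σ ^ 2 : ℝ≥0) : ℝ) := (NNReal.coe_pow σ 2).symm
  rw [hcast] at hrule ⊢
  exact ⟨fun n => (hrun.integral_regret hf hv n).1, hrun.bcr_le hf hk hv hrule T⟩
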